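/- Let $C_{it},C_{mea},C_{op},\Delta t,\alpha,\eta>0$, $\gamma\in\mathbb R$, $p\in(0,1)$, and suppose $C_{it}+C_{mea}+C_{op}\Delta t\le 1$. Let $\psi_1=(\log\Gamma)''$ be the trigamma function. A degradation test follows a gamma process $Z$, where $Z_t$ is gamma distributed with shape $\alpha t$ and rate $\alpha e^{-\gamma}$. Let $F_Q(t)=P(Z_t\ge\eta)$ be the distribution function of the lifetime (the first passage time of level $\eta$), $\xi_p=\inf\{t>0: F_Q(t)\ge p\}$ its $p$-th quantile, and $h=(h_1,h_2)=(\partial\xi_p/\partial\alpha,\partial\xi_p/\partial\gamma)$. A periodic (type-I) design is a triple of reals $\zeta=(n,m,\tau)$ ($n$ units, $m$ inspections, inspection interval $\tau$), with Fisher information matrix $$I(\zeta)=n\begin{pmatrix} m\tau^2\psi_1(\alpha\tau)-\frac{m\tau}{\alpha}&0\\0&\alpha m\tau\end{pmatrix}.$$ For D-, A- and V-optimality the objective is, respectively, $\phi_D=\det I(\zeta)^{-1}$, $\phi_A=\operatorname{tr} I(\zeta)^{-1}$, $\phi_V=h^{T}I(\zeta)^{-1}h$. The optimal design is the unique minimizer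 of the objective subject to $$C_{it}n+C_{mea}nm+C_{op}m\tau=1,\qquad \tau\ge\Delta t,\qquad n,m\ge1 .$$ Put $$\varphi_D(\tau)=\tfrac12\tfrac{d}{d\tau}\log\bigl(\alpha\tau^3\psi_1(\alpha\tau)-\tau^2\bigr),\quad \varphi_A(\tau)=-\tfrac{d}{d\tau}\log\Bigl[\tfrac{1}{\tau^2\psi_1(\alpha\tau)-\tau/\alpha}+\tfrac1{\alpha\tau}\Bigr],\quad \varphi_V(\tau)=-\tfrac{d}{d\tau}\log\Bigl[\tfrac{h_1^2}{\tau^2\psi_1(\alpha\tau)-\tau/\alpha}+\tfrac{h_2^2}{\alpha\tau}\Bigr],$$ $$K_1(\tau)=\Bigl(\tfrac{C_{mea}}{C_{op}}+\tau\Bigr)^{-1},\quad K_2(\tau)=\Bigl(\tfrac1{C_{op}}-\tau\Bigr)^{-1},\quad K_3(\tau)=\Bigl(\tau\sqrt{1+\tfrac{C_{mea}}{C_{op}C_{it}\tau}}\Bigr)^{-1},$$ $$n(\tau)=\frac{-C_{it}+\sqrt{C_{it}^2+\frac{C_{mea}C_{it}}{C_{op}\tau}}}{\frac{C_{mea}C_{it}}{C_{op}\tau}},\qquad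 m(\tau)=\frac{-C_{it}+\sqrt{C_{it}^2+\frac{C_{mea}C_{it}}{C_{op}\tau}}}{C_{mea}},$$ $$\kappa=1-2C_{it}-C_{mea},\quad \tau_l=\frac{C_{it}C_{mea}}{C_{op}(1-2C_{it})},\quad \tau_u=\frac{C_{it}}{C_{op}(C_{mea}+2C_{it})},\quad \tau_{\max}=\frac{1-C_{it}-C_{mea}}{C_{op}}.$$ For each of the three criteria, with the matching $\varphi\in\{\varphi_D,\varphi_A,\varphi_V\}$, the following holds. 1. If $\tau_1$ is the unique solution of $\varphi=K_1$ in $[\Delta t,\tau_{\max}]$, and either $\kappa>0$ and $\tau_l>\tau_1>\Delta t$, or $\kappa\le0$ and $\tau_{\max}>\tau_1>\Delta t$, then the optimal design is $\bigl(1,\frac{1-C_{it}}{C_{mea}+C_{op}\tau_1},\tau_1\bigr)$. 2. If $\tau_2$ is the unique solution of $\varphi=K_2$ in $[\Delta t,\tau_{\max}]$, $\kappa>0$ and $\tau_{\max}>\tau_2>\max(\tau_u,\Delta t)$, then the optimal design is $\bigl(\frac{1-C_{op}\tau_2}{C_{it}+C_{mea}},1,\tau_2\bigr)$. 3. If $\tau_3$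 is the unique solution of $\varphi=K_3$ in $[\Delta t,\tau_{\max}]$, $\kappa>0$ and $\tau_u>\tau_3>\max(\tau_l,\Delta t)$, then the optimal design is $(n(\tau_3),m(\tau_3),\tau_3)$. 4. If $\varphi(\tau_{\max})>\max\bigl(\frac{C_{op}}{C_{it}+C_{mea}},\frac{C_{op}}{1-C_{it}}\bigr)$, then the optimal design is $(1,1,\tau_{\max})$. 5. If $\varphi(\Delta t)<K_1(\Delta t)$ and either $\kappa>0$ and $\tau_l>\Delta t$, or $\kappa\le0$, then the optimal design is $\bigl(1,\frac{1-C_{it}}{C_{mea}+C_{op}\Delta t},\Delta t\bigr)$. 6. If $\varphi(\Delta t)<K_2(\Delta t)$, $\kappa>0$ and $\Delta t>\tau_u$, then the optimal design is $\bigl(\frac{1-C_{op}\Delta t}{C_{it}+C_{mea}},1,\Delta t\bigr)$. 7. If $\varphi(\Delta t)<K_3(\Delta t)$, $\kappa>0$ and $\tau_u>\Delta t>\tau_l$, then the optimal design is $(n(\Delta t),m(\Delta t),\Delta t)$. 8. If $C_{it}+C_{mea}+C_{op}\Delta t=1$, then the optimal design is $(1,1,\Delta t)$. Moreover, an optimal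 design always exists and falls into one of these eight cases, in the following sense: it has the form given in one of the cases 1–8 and satisfies the conditions of that case, where the strict comparisons of $\varphi$ with a bound (cases 4–7) and of $\tau_1,\tau_2,\tau_3,\Delta t$ with $\tau_l$ and $\tau_u$ are replaced by non-strict ones, and where in cases 1–3 its $\tau$ satisfies $\Delta t<\tau$ (and $\tau<\tau_{\max}$ in case 2 and in case 1 with $\kappa\le0$) and is a solution of $\varphi=K_i$ (without a uniqueness requirement). -/

import Mathlib

open ProbabilityTheory

namespace GammaDesign

noncomputable section

/-! ### The gamma degradation model -/

/-- The polygamma function of order `r`: the derivative of order `r + 1` of `log Γ`. -/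
def polygamma (r : ℕ) (x : ℝ) : ℝ :=
  iteratedDeriv (r + 1) (fun y : ℝ => Real.log (Real.Gamma y)) x

/-- The cdf at time `t` of the first passage time `Q = inf {t | Z t ≥ η}` of the gamma process
with parameters `(α, γ)`: as the paths are nondecreasing, it is `P (Z t ≥ η)`, where `Z t` is
gamma distributed with shape `α t` and rate `β = α exp (-γ)` (that is, `γ = log (α / β)`). -/
def lifetimeCDF (η α γ t : ℝ) : ℝ :=
  (gammaMeasure (α * t) (α * Real.exp (-γ))).real (Set.Ici η)

/-- The `p`-th quantile `ξ_p` of the lifetime. -/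
def lifetimeQuantile (η p α γ : ℝ) : ℝ :=
  sInf {t : ℝ | 0 < t ∧ p ≤ lifetimeCDF η α γ t}

/-- `h₁ = ∂ ξ_p / ∂ α`. -/
def h₁ (η p α γ : ℝ) : ℝ := deriv (fun a : ℝ => lifetimeQuantile η p a γ) α

/-- `h₂ = ∂ ξ_p / ∂ γ`. -/
def h₂ (η p α γ : ℝ) : ℝ := deriv (fun g : ℝ => lifetimeQuantile η p α g) γ

/-! ### Periodic designs and the three criteria -/

/-- A periodic design: `n` test units, `m` inspections, inspection interval `τ`
(`n` and `m` are treated as continuous variables). -/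
@[ext]
structure Design where
  n : ℝ
  m : ℝ
  τ : ℝ

/-- The Fisher information matrix of `(α, γ)` for a periodic design. -/
def fisherInfo (α : ℝ) (ζ : Design) : Matrix (Fin 2) (Fin 2) ℝ :=
  ζ.n • !![ζ.m * (ζ.τ ^ 2 * polygamma 1 (α * ζ.τ)) - ζ.m * ζ.τ / α, 0;
           0, α * (ζ.m * ζ.τ)]

/-- The three optimality criteria. -/
inductive Criterion
  | D
  | A
  | V

/-- The objective function, to be minimized: determinant (D) and trace (A) of the asymptotic
covariance matrix of the estimator of `(α, γ)`, asymptotic variance of the estimator of `ξ_p` (V). -/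
def objective (η p α γ : ℝ) : Criterion → Design → ℝ
  | .D, ζ => ((fisherInfo α ζ)⁻¹).det
  | .A, ζ => ((fisherInfo α ζ)⁻¹).trace
  | .V, ζ => ![h₁ η p α γ, h₂ η p α γ] ⬝ᵥ
      ((fisherInfo α ζ)⁻¹.mulVec ![h₁ η p α γ, h₂ η p α γ])

/-- The functions `φ_D`, `φ_A`, `φ_V` of the inspection interval. -/
def phi (η p α γ : ℝ) : Criterion → ℝ → ℝ
  | .D, τ => 1 / 2 *
      deriv (fun t : ℝ => Real.log (α * t ^ 3 * polygamma 1 (α * t) - t ^ 2)) τ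
  | .A, τ => -deriv (fun t : ℝ =>
      Real.log (1 / (t ^ 2 * polygamma 1 (α * t) - t / α) + 1 / (α * t))) τ
  | .V, τ => -deriv (fun t : ℝ =>
      Real.log (h₁ η p α γ ^ 2 / (t ^ 2 * polygamma 1 (α * t) - t / α)
        + h₂ η p α γ ^ 2 / (α * t))) τ

/-! ### The cost constraint -/

/-- Unit costs: per test unit, per inspection, per unit of operating time. -/
structure Costs where
  it : ℝ
  mea : ℝ
  op : ℝ

/-- Total cost of a design. -/
def Costs.total (C : Costs) (ζ : Design) : ℝ :=
  C.it * ζ.n + C.mea * (ζ.n * ζ.m) + C.op * (ζ.m * ζ.τ)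

/-- The feasible designs, with minimum inspection interval `δ`. -/
def Feasible (C : Costs) (δ : ℝ) (ζ : Design) : Prop :=
  C.total ζ = 1 ∧ δ ≤ ζ.τ ∧ 1 ≤ ζ.n ∧ 1 ≤ ζ.m

/-- `ζ` is the optimal design: the unique feasible minimizer of the objective function `f`. -/
def IsOptimalDesign (C : Costs) (δ : ℝ) (f : Design → ℝ) (ζ : Design) : Prop :=
  Feasible C δ ζ ∧ ∀ ζ' : Design, Feasible C δ ζ' → ζ' ≠ ζ → f ζ < f ζ'

/-- The largest inspection interval that the budget allows. -/
def Costs.tauMax (C : Costs) : ℝ := (1 - C.it - C.mea) / C.op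

/-- The lower threshold `τ_l`. -/
def Costs.tauL (C : Costs) : ℝ := C.it * C.mea / (C.op * (1 - 2 * C.it))

/-- The upper threshold `τ_u`. -/
def Costs.tauU (C : Costs) : ℝ := C.it / (C.op * (C.mea + 2 * C.it))

def Costs.K₁ (C : Costs) (τ : ℝ) : ℝ := (C.mea / C.op + τ)⁻¹

def Costs.K₂ (C : Costs) (τ : ℝ) : ℝ := (1 / C.op - τ)⁻¹

def Costs.K₃ (C : Costs) (τ : ℝ) : ℝ :=
  (τ * Real.sqrt (1 + C.mea / (C.op * C.it * τ)))⁻¹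

def Costs.nOpt (C : Costs) (τ : ℝ) : ℝ :=
  (-C.it + Real.sqrt (C.it ^ 2 + C.mea * C.it / (C.op * τ))) / (C.mea * C.it / (C.op * τ))

def Costs.mOpt (C : Costs) (τ : ℝ) : ℝ :=
  (-C.it + Real.sqrt (C.it ^ 2 + C.mea * C.it / (C.op * τ))) / C.mea

/-- The design with `n = 1` and interval `τ` that exhausts the budget. -/
def Costs.designN1 (C : Costs) (τ : ℝ) : Design := ⟨1, (1 - C.it) / (C.mea + C.op * τ), τ⟩

/-- The design with `m = 1` and interval `τ` that exhausts the budget. -/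
def Costs.designM1 (C : Costs) (τ : ℝ) : Design := ⟨(1 - C.op * τ) / (C.it + C.mea), 1, τ⟩

/-- The design `(n(τ), m(τ), τ)`. -/
def Costs.designNM (C : Costs) (τ : ℝ) : Design := ⟨C.nOpt τ, C.mOpt τ, τ⟩

/-- `τ` is the unique solution in `S` of the equation `f = g`. -/
def IsUniqueRootOn (f g : ℝ → ℝ) (S : Set ℝ) (τ : ℝ) : Prop :=
  τ ∈ S ∧ f τ = g τ ∧ ∀ t ∈ S, f t = g t → t = τ

end

end GammaDesign

namespace GammaDesign

open Filter Topology

/-! The information matrix is `n m` times a diagonal matrix depending only on `τ`. Hence each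
objective is `exp (-(c (log (n m) + L τ)))` with `c > 0` and `L' = φ` (`objective_eq`,
`exists_elasticity`). The problem splits: for each `τ`, make `n m` as large as the budget allows,
then maximise over `τ` in `[δ, τ_max]`.

For fixed `τ`, a given product `n m` is cheapest when `C_it n = C_op m τ` (AM-GM); this balance is
`(n(τ), m(τ))`. It violates `n ≥ 1` below `τ_l` and `m ≥ 1` above `τ_u`, where that constraint binds
instead. When `κ ≤ 0`, `n = 1` is best for every affordable `τ`. The logarithm of the best size has
derivative `-k`, with `k` equal to `K₁`, `K₃` or `K₂` according to the regime. At the thresholds the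
pieces agree in value and slope.

The remaining function of `τ` has derivative `φ - k`. The crucial fact is single crossing
(`CrossesDown`): once `φ ≤ k`, strictly `φ < k` afterwards. The function is then strictly unimodal,
and the sign of `φ - k` at an endpoint, or a zero of it, locates the unique optimum. Existence
follows from Darboux's theorem.

For single crossing it suffices that `φ - k` has negative derivative at its zeros. Write `φ τ = q (α
τ) / τ` with an elasticity `q`, and `z = τ k τ`. Then `τ² k'` is `-z²`, `-(z + z³)/2`, `z²` for
`K₁`, `K₃`, `K₂`, and all three cases follow from `2 x q' ≤ q (1 - q²)`, strict when `q < 1`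
(`ElasticityBound`). This reduces to the elasticity `s` of `u x = x² ψ₁ x - x`: one needs `s ≤ 0`,
`x s' ≤ -s - s²` and, for D-optimality, `s > -2/5`. The middle bound is concavity of `x u x`, that
is `∑ k²/(x+k)⁴ ≤ 1/(3x)`, which is Lazarević's inequality `v³ cosh v ≤ sinh³ v` after a Laplace
transform.

V-optimality also uses `h₂ ≠ 0`, to give the second weight positivity. The quantile is `s(x)/α` at
`x = α e^{-γ} η`, where `s` (here an implicit function) solves an equation for the regularized
incomplete gamma function and has nonzero derivative. -/

/-! ### Series for the trigamma function -/

/-- The tail `∑_{k ≥ 1} (x + k)⁻ʲ` of the Hurwitz zeta series. -/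
noncomputable def hurwitzTail (j : ℕ) (x : ℝ) : ℝ := ∑' k : ℕ, 1 / (x + (k + 1)) ^ j

lemma summable_one_div_succ_pow {j : ℕ} (hj : 2 ≤ j) :
    Summable fun k : ℕ => 1 / ((k : ℝ) + 1) ^ j := by
  have := (summable_nat_add_iff 1).mpr (Real.summable_one_div_nat_pow (p := j) |>.mpr (by omega))
  simpa using this

lemma summable_hurwitzTail {j : ℕ} (hj : 2 ≤ j) {x : ℝ} (hx : 0 < x) :
    Summable fun k : ℕ => 1 / (x + (k + 1)) ^ j := by
  refine Summable.of_nonneg_of_le (fun k => by positivity) (fun k => ?_)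
    (summable_one_div_succ_pow hj)
  gcongr 1 / ?_ ^ _
  linarith

lemma hasDerivAt_hurwitzTail {j : ℕ} (hj : 2 ≤ j) {x : ℝ} (hx : 0 < x) :
    HasDerivAt (hurwitzTail j) (-j * hurwitzTail (j + 1) x) x := by
  have h := hasDerivAt_tsum_of_isPreconnected (t := Set.Ioi (0 : ℝ))
    (u := fun k : ℕ => j * (1 / ((k : ℝ) + 1) ^ (j + 1)))
    (g := fun (k : ℕ) (y : ℝ) => 1 / (y + (k + 1)) ^ j)
    (g' := fun (k : ℕ) (y : ℝ) => -j * (1 / (y + (k + 1)) ^ (j + 1)))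
    (y₀ := x) (y := x) ((summable_one_div_succ_pow (by omega)).mul_left _) isOpen_Ioi
    isPreconnected_Ioi ?_ ?_ hx (summable_hurwitzTail hj hx) hx
  · rw [tsum_mul_left] at h
    exact h
  · intro k y hy
    have hy' : 0 < y := hy
    have hne : y + (k + 1) ≠ 0 := by positivity
    have h1 : HasDerivAt (fun y : ℝ => (y + (k + 1)) ^ j)
        (j * (y + (k + 1)) ^ (j - 1) * 1) y := ((hasDerivAt_id y).add_const _).pow j
    have h2 := h1.inv (pow_ne_zero j hne)
    have e : (fun y : ℝ => 1 / (y + ((k : ℝ) + 1)) ^ j) = (fun y : ℝ => (y + (k + 1)) ^ j)⁻¹ := by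
      ext; simp
    rw [e]
    refine h2.congr_deriv ?_
    obtain ⟨i, rfl⟩ : ∃ i, j = i + 1 := ⟨j - 1, by omega⟩
    rw [Nat.add_sub_cancel]
    field_simp
    ring
  · intro k y hy
    have hy' : 0 < y := hy
    rw [norm_mul, norm_neg, Real.norm_natCast, Real.norm_of_nonneg (by positivity)]
    gcongr j * (1 / ?_ ^ _)
    linarith

/-- The Weierstrass product of the Gamma function, in logarithmic form. -/
lemma hasSum_log_Gamma {x : ℝ} (hx : 0 < x) :
    HasSum (fun k : ℕ => x / (k + 1) - (Real.log (x + (k + 1)) - Real.log (k + 1)))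
      (Real.log (Real.Gamma x) + Real.log x + Real.eulerMascheroniConstant * x) := by
  rw [hasSum_iff_tendsto_nat_of_nonneg]
  -- Adding `log x` removes the `k = 0` factor of Euler's limit, and adding `x (H_n - log n)` turns
  -- `x log n` into the convergence terms `x / (k + 1)`.
  · have h1 := Real.BohrMollerup.tendsto_log_gamma hx
    have h2 := (Real.tendsto_harmonic_sub_log).mul_const x
    refine ((h1.add_const (Real.log x)).add h2).congr fun n => ?_
    have hfac : Real.log (n.factorial : ℝ) = ∑ k ∈ Finset.range n, Real.log ((k : ℝ) + 1) := by
      rw [← Finset.prod_range_add_one_eq_factorial]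
      push_cast
      rw [Real.log_prod (fun k _ => by positivity)]
    have hh : ((harmonic n : ℚ) : ℝ) * x = ∑ k ∈ Finset.range n, x / ((k : ℝ) + 1) := by
      rw [harmonic]
      push_cast
      rw [Finset.sum_mul]
      exact Finset.sum_congr rfl fun k _ => by rw [div_eq_inv_mul]
    rw [Real.BohrMollerup.logGammaSeq, hfac, Finset.sum_range_succ', sub_mul, hh,
      Finset.sum_sub_distrib, Finset.sum_sub_distrib]
    push_cast
    ring_nf
  · intro k
    have hk : (0 : ℝ) < k + 1 := by positivity
    rw [← Real.log_div (by positivity) hk.ne']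
    have := Real.log_le_sub_one_of_pos (x := (x + (k + 1)) / (k + 1)) (by positivity)
    have e : (x + (k + 1)) / ((k : ℝ) + 1) - 1 = x / (k + 1) := by field_simp; ring
    linarith

lemma hasDerivAt_log_Gamma {x : ℝ} (hx : 0 < x) :
    HasDerivAt (fun y : ℝ => Real.log (Real.Gamma y))
      ((∑' k : ℕ, (1 / ((k : ℝ) + 1) - 1 / (x + (k + 1)))) - x⁻¹
        - Real.eulerMascheroniConstant) x := by
  -- The differentiated terms are `y / ((k+1)(y+k+1))`, which the summable majorant dominates only
  -- for bounded `y`; hence an interval instead of the half-line.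
  have h := hasDerivAt_tsum_of_isPreconnected (t := Set.Ioo (0 : ℝ) (x + 1))
    (u := fun k : ℕ => (x + 1) * (1 / ((k : ℝ) + 1) ^ 2))
    (g := fun (k : ℕ) (y : ℝ) => y / (k + 1) - (Real.log (y + (k + 1)) - Real.log (k + 1)))
    (g' := fun (k : ℕ) (y : ℝ) => 1 / ((k : ℝ) + 1) - 1 / (y + (k + 1)))
    (y₀ := x) (y := x) ((summable_one_div_succ_pow le_rfl).mul_left _) isOpen_Ioo
    isPreconnected_Ioo ?_ ?_ ⟨hx, by linarith⟩ (hasSum_log_Gamma hx).summable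
    ⟨hx, by linarith⟩
  · have h2 := (h.sub (Real.hasDerivAt_log hx.ne')).sub
      ((hasDerivAt_id x).const_mul Real.eulerMascheroniConstant)
    rw [mul_one] at h2
    refine h2.congr_of_eventuallyEq ?_
    filter_upwards [lt_mem_nhds hx] with y hy
    simp only [Pi.sub_apply, (hasSum_log_Gamma hy).tsum_eq, id]
    ring
  · rintro k y ⟨hy, -⟩
    have hne : y + (k + 1) ≠ 0 := by positivity
    exact ((hasDerivAt_id y).div_const _).sub
      ((((hasDerivAt_id y).add_const _).log hne).sub_const _)
  · rintro k y ⟨hy, hy'⟩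
    have e : 1 / ((k : ℝ) + 1) - 1 / (y + (k + 1)) = y * (1 / ((k + 1) * (y + (k + 1)))) := by
      field_simp; ring
    rw [e, Real.norm_of_nonneg (by positivity), pow_two]
    gcongr ?_ * (1 / (_ * ?_))
    linarith

/-- The trigamma function as a series. -/
lemma polygamma_one_eq {x : ℝ} (hx : 0 < x) :
    polygamma 1 x = 1 / x ^ 2 + hurwitzTail 2 x := by
  have h := hasDerivAt_tsum_of_isPreconnected (t := Set.Ioi (0 : ℝ))
    (u := fun k : ℕ => 1 / ((k : ℝ) + 1) ^ 2)
    (g := fun (k : ℕ) (y : ℝ) => 1 / ((k : ℝ) + 1) - 1 / (y + (k + 1)))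
    (g' := fun (k : ℕ) (y : ℝ) => 1 / (y + (k + 1)) ^ 2)
    (y₀ := x) (y := x) (summable_one_div_succ_pow le_rfl) isOpen_Ioi
    isPreconnected_Ioi ?_ ?_ hx ?_ hx
  · have h2 := (h.sub (hasDerivAt_inv hx.ne')).sub_const Real.eulerMascheroniConstant
    rw [polygamma, iteratedDeriv_succ, iteratedDeriv_one]
    have h3 : deriv (fun y : ℝ => Real.log (Real.Gamma y)) =ᶠ[𝓝 x]
        fun y => (∑' k : ℕ, (1 / ((k : ℝ) + 1) - 1 / (y + (k + 1)))) - y⁻¹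
          - Real.eulerMascheroniConstant := by
      filter_upwards [lt_mem_nhds hx] with y hy using (hasDerivAt_log_Gamma hy).deriv
    rw [h3.deriv_eq]
    refine (h2.deriv).trans ?_
    rw [hurwitzTail, one_div]
    ring
  · intro k y hy
    have hy' : 0 < y := hy
    have hne : y + (k + 1) ≠ 0 := by positivity
    simp only [one_div]
    have h1 := (((hasDerivAt_id y).add_const ((k : ℝ) + 1)).inv hne).const_sub (((k : ℝ) + 1)⁻¹)
    refine (h1.congr_deriv ?_).congr_of_eventuallyEq (Eventually.of_forall fun z => ?_) <;>
      simp [neg_div]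
  · intro k y hy
    have hy' : 0 < y := hy
    rw [Real.norm_of_nonneg (by positivity)]
    gcongr 1 / ?_ ^ _
    linarith
  · refine Summable.of_nonneg_of_le (fun k => ?_) (fun k => ?_)
      ((summable_one_div_succ_pow le_rfl).mul_left x)
    · rw [sub_nonneg]
      gcongr 1 / ?_
      linarith
    · have e : 1 / ((k : ℝ) + 1) - 1 / (x + (k + 1)) = x * (1 / ((k + 1) * (x + (k + 1)))) := by
        field_simp; ring
      rw [e, pow_two]
      gcongr _ * (1 / (_ * ?_))
      linarith

/-! ### Inequalities for the trigamma function -/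

/-- **Lazarević's inequality**. -/
lemma pow_three_mul_cosh_le_sinh_pow_three {v : ℝ} (hv : 0 ≤ v) :
    v ^ 3 * Real.cosh v ≤ Real.sinh v ^ 3 := by
  have key : ∀ w : ℝ, ∃ h', HasDerivAt
      (fun w : ℝ => Real.sinh w * Real.cosh w ^ (-(1 / 3) : ℝ) - w) h' w ∧ 0 ≤ h' := by
    intro w
    have hC := Real.cosh_pos w
    have hd := ((Real.hasDerivAt_sinh w).mul
      ((Real.hasDerivAt_cosh w).rpow_const (p := (-(1 / 3) : ℝ)) (Or.inl hC.ne'))).sub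
      (hasDerivAt_id w)
    refine ⟨_, hd, ?_⟩
    -- In terms of `d = cosh^(-1/3)` the derivative is rational, because `cosh = d⁻³` and `sinh² =
    -- d⁻⁶ - 1`; it then factors with a visible square.
    set d := Real.cosh w ^ (-(1 / 3) : ℝ) with hd_def
    have hdpos : 0 < d := Real.rpow_pos_of_pos hC _
    have h3 : d ^ 3 * Real.cosh w = 1 := by
      rw [hd_def, ← Real.rpow_natCast, ← Real.rpow_mul hC.le]
      norm_num
      rw [Real.rpow_neg_one, inv_mul_cancel₀ hC.ne']
    have h4 : Real.cosh w ^ (-(1 / 3) - 1 : ℝ) = d ^ 4 := by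
      rw [hd_def, ← Real.rpow_natCast, ← Real.rpow_mul hC.le]
      norm_num
    have hs : Real.sinh w * Real.sinh w = Real.cosh w ^ 2 - 1 := by
      rw [← pow_two, Real.sinh_sq]
    have hc : Real.cosh w = 1 / d ^ 3 := by field_simp; linarith
    rw [h4]
    have e : Real.cosh w * d + Real.sinh w * (Real.sinh w * (-(1 / 3)) * d ^ 4) - 1
        = (d ^ 2 - 1) ^ 2 * (d ^ 2 + 2) / (3 * d ^ 2) := by
      rw [show Real.sinh w * (Real.sinh w * (-(1 / 3)) * d ^ 4)
        = (Real.sinh w * Real.sinh w) * (-(1 / 3)) * d ^ 4 by ring, hs, hc]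
      field_simp
      ring
    rw [e]
    positivity
  have hmono : Monotone (fun w : ℝ => Real.sinh w * Real.cosh w ^ (-(1 / 3) : ℝ) - w) :=
    monotone_of_deriv_nonneg (fun w => (key w).choose_spec.1.differentiableAt)
      (fun w => by rw [(key w).choose_spec.1.deriv]; exact (key w).choose_spec.2)
  have h0 := hmono hv
  simp only [Real.sinh_zero, zero_mul, sub_zero] at h0
  have hC := Real.cosh_pos v
  have h1 : v ≤ Real.sinh v * Real.cosh v ^ (-(1 / 3) : ℝ) := by linarith
  have h3 : (Real.cosh v ^ (-(1 / 3) : ℝ)) ^ 3 * Real.cosh v = 1 := by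
    rw [← Real.rpow_natCast, ← Real.rpow_mul hC.le]
    norm_num
    rw [Real.rpow_neg_one, inv_mul_cancel₀ hC.ne']
  calc v ^ 3 * Real.cosh v
      ≤ (Real.sinh v * Real.cosh v ^ (-(1 / 3) : ℝ)) ^ 3 * Real.cosh v := by gcongr
    _ = Real.sinh v ^ 3 * ((Real.cosh v ^ (-(1 / 3) : ℝ)) ^ 3 * Real.cosh v) := by ring
    _ = Real.sinh v ^ 3 := by rw [h3, mul_one]

/-- The bound is the value of the full series. An explicit nonnegative remainder, checked by
induction, avoids any limit. -/
lemma sum_sq_mul_pow_le {q : ℝ} (hq₀ : 0 ≤ q) (hq₁ : q < 1) (N : ℕ) :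
    ∑ k ∈ Finset.range N, ((k : ℝ) + 1) ^ 2 * q ^ (k + 1) ≤ q * (1 + q) / (1 - q) ^ 3 := by
  have hq : 0 < 1 - q := by linarith
  have h : ∑ k ∈ Finset.range N, ((k : ℝ) + 1) ^ 2 * q ^ (k + 1) = q * (1 + q) / (1 - q) ^ 3
      - q ^ (N + 1) * (((N : ℝ) + 1) ^ 2 / (1 - q) + 2 * (N + 1) * q / (1 - q) ^ 2
        + q * (1 + q) / (1 - q) ^ 3) := by
    induction N with
    | zero => simp; field_simp; ring
    | succ n ih =>
      rw [Finset.sum_range_succ, ih]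
      push_cast
      field_simp
      ring
  rw [h, sub_le_self_iff]
  positivity

/-- With `v = t / 2` the full series is `cosh v / (4 sinh³ v)`, so this is Lazarević's inequality.
It is the pointwise bound to be integrated against `exp (-(x t))`. -/
lemma pow_three_mul_sum_exp_le {t : ℝ} (ht : 0 < t) (N : ℕ) :
    t ^ 3 * ∑ k ∈ Finset.range N, ((k : ℝ) + 1) ^ 2 * Real.exp (-t) ^ (k + 1) ≤ 2 := by
  have hq : Real.exp (-t) < 1 := by simpa using ht
  have h1 := sum_sq_mul_pow_le (Real.exp_pos (-t)).le hq N
  have h2 := pow_three_mul_cosh_le_sinh_pow_three (v := t / 2) (by positivity)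
  set E := Real.exp (-(t / 2)) with hE
  have hEpos : 0 < E := Real.exp_pos _
  have hqE : Real.exp (-t) = E ^ 2 := by
    rw [hE, ← Real.exp_nat_mul]; congr 1; push_cast; ring
  have hE' : Real.exp (t / 2) = 1 / E := by rw [hE, Real.exp_neg, one_div, inv_inv]
  rw [Real.cosh_eq, Real.sinh_eq, hE', ← hE] at h2
  rw [hqE] at hq h1 ⊢
  have hpos : 0 < 1 - E ^ 2 := by linarith
  have h3 : t ^ 3 * (E ^ 2 * (1 + E ^ 2)) ≤ 2 * (1 - E ^ 2) ^ 3 := by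
    have e1 : (t / 2) ^ 3 * ((1 / E + E) / 2) = t ^ 3 * (E ^ 2 * (1 + E ^ 2)) / (16 * E ^ 3) := by
      field_simp; ring
    have e2 : ((1 / E - E) / 2) ^ 3 = 2 * (1 - E ^ 2) ^ 3 / (16 * E ^ 3) := by
      field_simp; ring
    rw [e1, e2] at h2
    exact (div_le_div_iff_of_pos_right (by positivity)).mp h2
  calc _ ≤ t ^ 3 * (E ^ 2 * (1 + E ^ 2) / (1 - E ^ 2) ^ 3) := by gcongr
    _ = t ^ 3 * (E ^ 2 * (1 + E ^ 2)) / (1 - E ^ 2) ^ 3 := by ring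
    _ ≤ 2 := by rwa [div_le_iff₀ (by positivity)]

lemma integral_pow_three_mul_exp {r : ℝ} (hr : 0 < r) :
    ∫ t in Set.Ioi (0 : ℝ), t ^ 3 * Real.exp (-(r * t)) = 6 / r ^ 4 := by
  have h := Real.integral_rpow_mul_exp_neg_mul_Ioi (a := 4) (by norm_num) hr
  have hG : Real.Gamma 4 = 6 := by
    rw [show (4 : ℝ) = ((3 : ℕ) : ℝ) + 1 by norm_num, Real.Gamma_nat_eq_factorial]
    norm_num [Nat.factorial]
  rw [hG] at h
  have e : (4 - 1 : ℝ) = ((3 : ℕ) : ℝ) := by norm_num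
  have e' : (4 : ℝ) = ((4 : ℕ) : ℝ) := by norm_num
  rw [e] at h
  simp only [Real.rpow_natCast] at h
  rw [h, e', Real.rpow_natCast]
  field_simp

lemma integral_exp_neg_mul {r : ℝ} (hr : 0 < r) :
    ∫ t in Set.Ioi (0 : ℝ), Real.exp (-(r * t)) = 1 / r := by
  have h := Real.integral_rpow_mul_exp_neg_mul_Ioi (a := 1) (by norm_num) hr
  simpa using h

/-- Since `6 / r⁴` is the Laplace transform of `t³` at `r`, six times the sum is at most the Laplace
transform of the constant `2` at `x`. -/
lemma sum_sq_div_pow_four_le {x : ℝ} (hx : 0 < x) (N : ℕ) :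
    ∑ k ∈ Finset.range N, ((k : ℝ) + 1) ^ 2 / (x + (k + 1)) ^ 4 ≤ 1 / (3 * x) := by
  have hint : ∀ k : ℕ, MeasureTheory.IntegrableOn
      (fun t : ℝ => t ^ 3 * Real.exp (-((x + (k + 1)) * t))) (Set.Ioi 0) := by
    intro k
    -- A non-integrable function has integral `0` by convention, so the positive value computed
    -- above forces integrability.
    by_contra h
    have h1 := integral_pow_three_mul_exp (r := x + (k + 1)) (by positivity)
    rw [MeasureTheory.integral_undef h] at h1
    have : 0 < 6 / (x + ((k : ℝ) + 1)) ^ 4 := by positivity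
    linarith
  have hint' : MeasureTheory.IntegrableOn (fun t : ℝ => Real.exp (-(x * t))) (Set.Ioi 0) := by
    by_contra h
    have h1 := integral_exp_neg_mul hx
    rw [MeasureTheory.integral_undef h] at h1
    have : 0 < 1 / x := by positivity
    linarith
  have h1 : ∑ k ∈ Finset.range N, ((k : ℝ) + 1) ^ 2 * (6 / (x + (k + 1)) ^ 4) ≤ 2 * (1 / x) := by
    rw [← integral_exp_neg_mul hx, ← MeasureTheory.integral_const_mul]
    have e : ∀ k ∈ Finset.range N, ((k : ℝ) + 1) ^ 2 * (6 / (x + (k + 1)) ^ 4) =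
        ∫ t in Set.Ioi (0 : ℝ), ((k : ℝ) + 1) ^ 2 *
          (t ^ 3 * Real.exp (-((x + (k + 1)) * t))) := fun k _ => by
      rw [MeasureTheory.integral_const_mul, integral_pow_three_mul_exp (by positivity)]
    rw [Finset.sum_congr rfl e, ← MeasureTheory.integral_finsetSum _
      (fun k _ => (hint k).const_mul _)]
    refine MeasureTheory.setIntegral_mono_on
      (MeasureTheory.integrable_finsetSum _ fun k _ => (hint k).const_mul _)
      (hint'.const_mul 2) measurableSet_Ioi fun t ht => ?_
    have h2 := pow_three_mul_sum_exp_le (t := t) ht N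
    calc ∑ k ∈ Finset.range N, ((k : ℝ) + 1) ^ 2 * (t ^ 3 * Real.exp (-((x + (k + 1)) * t)))
        = (t ^ 3 * ∑ k ∈ Finset.range N, ((k : ℝ) + 1) ^ 2 * Real.exp (-t) ^ (k + 1))
          * Real.exp (-(x * t)) := by
          rw [Finset.mul_sum, Finset.sum_mul]
          refine Finset.sum_congr rfl fun k _ => ?_
          rw [← Real.exp_nat_mul, show -((x + ((k : ℝ) + 1)) * t)
            = ((k + 1 : ℕ) : ℝ) * -t + -(x * t) by push_cast; ring, Real.exp_add]
          ring
      _ ≤ 2 * Real.exp (-(x * t)) := by gcongr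
  have h2 : ∑ k ∈ Finset.range N, ((k : ℝ) + 1) ^ 2 * (6 / (x + (k + 1)) ^ 4)
      = 6 * ∑ k ∈ Finset.range N, ((k : ℝ) + 1) ^ 2 / (x + (k + 1)) ^ 4 := by
    rw [Finset.mul_sum]
    exact Finset.sum_congr rfl fun k _ => by ring
  have e : 1 / (3 * x) = 2 * (1 / x) / 6 := by field_simp; norm_num
  rw [e]
  linarith

/-- With `y = x + k` the terms combine to `(y - x)² / y⁴ = k² / (x + k)⁴`. The right side is the
integral of `s² / (x + s)⁴` over `s > 0`. -/
lemma hurwitzTail_combination_le {x : ℝ} (hx : 0 < x) :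
    hurwitzTail 2 x - 2 * x * hurwitzTail 3 x + x ^ 2 * hurwitzTail 4 x ≤ 1 / (3 * x) := by
  have s2 := summable_hurwitzTail (j := 2) le_rfl hx
  have s3 := summable_hurwitzTail (j := 3) (by norm_num) hx
  have s4 := summable_hurwitzTail (j := 4) (by norm_num) hx
  have h := (s2.hasSum.sub (s3.hasSum.mul_left (2 * x))).add (s4.hasSum.mul_left (x ^ 2))
  rw [hurwitzTail, hurwitzTail, hurwitzTail, ← h.tsum_eq]
  have e : ∀ k : ℕ, 1 / (x + ((k : ℝ) + 1)) ^ 2 - 2 * x * (1 / (x + (k + 1)) ^ 3)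
      + x ^ 2 * (1 / (x + (k + 1)) ^ 4) = ((k : ℝ) + 1) ^ 2 / (x + (k + 1)) ^ 4 := by
    intro k; field_simp; ring
  simp only [e]
  exact Real.tsum_le_of_sum_range_le (fun k => by positivity) (sum_sq_div_pow_four_le hx)

/-- The terms combine to `k / (x + k)³`. Replacing the cube `y³` by the smaller `(y - 1) y (y + 1)`
makes the partial sums explicit, and their limit is `1 / (2x)`. -/
lemma hurwitzTail_two_sub_le {x : ℝ} (hx : 0 < x) :
    hurwitzTail 2 x - x * hurwitzTail 3 x ≤ 1 / (2 * x) := by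
  have s2 := summable_hurwitzTail (j := 2) le_rfl hx
  have s3 := summable_hurwitzTail (j := 3) (by norm_num) hx
  have h := s2.hasSum.sub (s3.hasSum.mul_left x)
  rw [hurwitzTail, hurwitzTail, ← h.tsum_eq]
  have e : ∀ k : ℕ, 1 / (x + ((k : ℝ) + 1)) ^ 2 - x * (1 / (x + (k + 1)) ^ 3)
      = ((k : ℝ) + 1) / (x + (k + 1)) ^ 3 := by
    intro k; field_simp; ring
  simp only [e]
  refine Real.tsum_le_of_sum_range_le (fun k => by positivity) fun N => ?_
  have h1 : ∑ k ∈ Finset.range N, ((k : ℝ) + 1) / (x + (k + 1)) ^ 3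
      ≤ N * (N + 1) / (2 * x * ((x + N) * (x + N + 1))) := by
    induction N with
    | zero => simp
    | succ n ih =>
      rw [Finset.sum_range_succ]
      have e1 : ((n + 1 : ℕ) : ℝ) * ((n + 1 : ℕ) + 1) /
            (2 * x * ((x + (n + 1 : ℕ)) * (x + (n + 1 : ℕ) + 1)))
          - n * (n + 1) / (2 * x * ((x + n) * (x + n + 1)))
          = ((n : ℝ) + 1) / ((x + n) * (x + n + 1) * (x + n + 2)) := by
        push_cast
        field_simp
        ring
      have e2 : ((n : ℝ) + 1) / (x + (n + 1)) ^ 3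
          ≤ ((n : ℝ) + 1) / ((x + n) * (x + n + 1) * (x + n + 2)) := by
        refine div_le_div_of_nonneg_left (by positivity) (by positivity) ?_
        have : 0 < x + (n + 1) := by positivity
        nlinarith
      linarith
  refine h1.trans ?_
  rw [div_le_div_iff₀ (by positivity) (by positivity)]
  have hN : (0 : ℝ) ≤ N := N.cast_nonneg
  have : (N : ℝ) * (N + 1) ≤ (x + N) * (x + N + 1) := by nlinarith
  nlinarith

lemma le_tsum_of_telescoping {a T : ℕ → ℝ} (ha : Summable a) (h0 : ∀ k, 0 ≤ a k)
    (h : ∀ k, T k - T (k + 1) ≤ a k) (hT : Tendsto T atTop (𝓝 0)) : T 0 ≤ ∑' k, a k := by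
  have h1 : ∀ N, T 0 - T N ≤ ∑' k, a k := fun N => by
    rw [← Finset.sum_range_sub']
    exact (Finset.sum_le_sum fun k _ => h k).trans (ha.sum_le_tsum _ fun k _ => h0 k)
  have h2 := hT.const_sub (T 0)
  rw [sub_zero] at h2
  exact le_of_tendsto' h2 h1

lemma tsum_le_of_telescoping {a T : ℕ → ℝ} (h0 : ∀ k, 0 ≤ a k)
    (h : ∀ k, a k ≤ T k - T (k + 1)) (hT : ∀ k, 0 ≤ T k) : ∑' k, a k ≤ T 0 := by
  refine Real.tsum_le_of_sum_range_le h0 fun N => ?_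
  have := Finset.sum_le_sum fun k (_ : k ∈ Finset.range N) => h k
  rw [Finset.sum_range_sub'] at this
  linarith [hT N]

/-- Euler–Maclaurin truncated after the boundary term: the truncation telescopes, with the one-step
error of one sign. -/
lemma le_hurwitzTail_two {x : ℝ} (hx : 0 < x) :
    1 / (x + 1) + 1 / (2 * (x + 1) ^ 2) ≤ hurwitzTail 2 x := by
  have hlim : Tendsto (fun k : ℕ => 1 / (x + ((k : ℝ) + 1))) atTop (𝓝 0) := by
    simp only [one_div]
    exact tendsto_inv_atTop_zero.comp (tendsto_atTop_add_const_left _ _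
      (tendsto_atTop_add_const_right _ _ tendsto_natCast_atTop_atTop))
  have h := le_tsum_of_telescoping (T := fun k : ℕ => 1 / (x + ((k : ℝ) + 1))
      + 1 / 2 * (1 / (x + ((k : ℝ) + 1))) ^ 2)
    (summable_hurwitzTail (j := 2) le_rfl hx) (fun k => by positivity) (fun k => ?_) ?_
  · rw [hurwitzTail]
    refine le_trans (le_of_eq ?_) h
    simp
    ring
  · push_cast
    obtain ⟨y, hy⟩ : ∃ y : ℝ, y = x + (k + 1) := ⟨_, rfl⟩
    have hy0 : 0 < y := by rw [hy]; positivity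
    rw [show x + ((k : ℝ) + 1 + 1) = y + 1 by rw [hy]; ring, ← hy, ← sub_nonneg]
    have : 1 / y ^ 2 - (1 / y + 1 / 2 * (1 / y) ^ 2 - (1 / (y + 1) + 1 / 2 * (1 / (y + 1)) ^ 2))
        = 1 / (2 * y ^ 2 * (y + 1) ^ 2) := by
      field_simp; ring
    rw [this]
    positivity
  · have := hlim.add ((hlim.pow 2).const_mul (1 / 2))
    norm_num at this ⊢
    exact this

/-- The same telescoping with one more Euler–Maclaurin term, which reverses the sign of the error.
-/
lemma hurwitzTail_three_le {x : ℝ} (hx : 0 < x) :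
    hurwitzTail 3 x ≤
      1 / (2 * (x + 1) ^ 2) + 1 / (2 * (x + 1) ^ 3) + 1 / (4 * (x + 1) ^ 4) := by
  have h := tsum_le_of_telescoping (a := fun k : ℕ => 1 / (x + ((k : ℝ) + 1)) ^ 3)
    (T := fun k : ℕ => 1 / (2 * (x + ((k : ℝ) + 1)) ^ 2) + 1 / (2 * (x + ((k : ℝ) + 1)) ^ 3)
      + 1 / (4 * (x + ((k : ℝ) + 1)) ^ 4))
    (fun k => by positivity) (fun k => ?_) (fun k => by positivity)
  · rw [hurwitzTail]
    refine h.trans (le_of_eq ?_)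
    simp
  · push_cast
    obtain ⟨y, hy⟩ : ∃ y : ℝ, y = x + (k + 1) := ⟨_, rfl⟩
    have hy0 : 0 < y := by rw [hy]; positivity
    rw [show x + ((k : ℝ) + 1 + 1) = y + 1 by rw [hy]; ring, ← hy, ← sub_nonneg]
    have : (1 / (2 * y ^ 2) + 1 / (2 * y ^ 3) + 1 / (4 * y ^ 4)
        - (1 / (2 * (y + 1) ^ 2) + 1 / (2 * (y + 1) ^ 3) + 1 / (4 * (y + 1) ^ 4))) - 1 / y ^ 3
        = (2 * y + 1) / (4 * y ^ 4 * (y + 1) ^ 4) := by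
      field_simp; ring
    rw [this]
    positivity

/-! ### The information function `x² ψ₁(x) - x` -/

/-- `x² ψ₁(x) - x`, in terms of the series of the trigamma function. -/
noncomputable def shapeInfo (x : ℝ) : ℝ := 1 + x ^ 2 * hurwitzTail 2 x - x

/-- The derivative of `shapeInfo`. -/
noncomputable def shapeInfoDeriv (x : ℝ) : ℝ :=
  2 * x * hurwitzTail 2 x - 2 * x ^ 2 * hurwitzTail 3 x - 1

/-- The second derivative of `shapeInfo`. -/
noncomputable def shapeInfoDeriv₂ (x : ℝ) : ℝ :=
  2 * hurwitzTail 2 x - 8 * x * hurwitzTail 3 x + 6 * x ^ 2 * hurwitzTail 4 x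

lemma shapeInfo_eq {x : ℝ} (hx : 0 < x) : shapeInfo x = x ^ 2 * polygamma 1 x - x := by
  rw [polygamma_one_eq hx, shapeInfo]
  field_simp

lemma hasDerivAt_shapeInfo {x : ℝ} (hx : 0 < x) :
    HasDerivAt shapeInfo (shapeInfoDeriv x) x := by
  have h := ((((hasDerivAt_id x).pow 2).mul (hasDerivAt_hurwitzTail le_rfl hx)).const_add 1).sub
    (hasDerivAt_id x)
  refine h.congr_deriv ?_
  simp only [shapeInfoDeriv, id, Nat.cast_ofNat, Nat.reduceAdd, Nat.reduceSub, Pi.pow_apply]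
  ring

lemma hasDerivAt_shapeInfoDeriv {x : ℝ} (hx : 0 < x) :
    HasDerivAt shapeInfoDeriv (shapeInfoDeriv₂ x) x := by
  have h := ((((hasDerivAt_id x).const_mul 2).mul (hasDerivAt_hurwitzTail (j := 2) le_rfl hx)).sub
    ((((hasDerivAt_id x).pow 2).const_mul 2).mul
      (hasDerivAt_hurwitzTail (j := 3) (by norm_num) hx))).sub_const 1
  refine h.congr_deriv ?_
  simp only [shapeInfoDeriv₂, id, Nat.cast_ofNat, Nat.reduceAdd, Nat.reduceSub, Pi.pow_apply]
  ring

lemma shapeInfo_pos {x : ℝ} (hx : 0 < x) : 0 < shapeInfo x := by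
  have h := le_hurwitzTail_two hx
  have h1 : 1 / (x + 1) ≤ hurwitzTail 2 x := by
    have : 0 < 1 / (2 * (x + 1) ^ 2) := by positivity
    linarith
  have h2 : x ^ 2 * (1 / (x + 1)) ≤ x ^ 2 * hurwitzTail 2 x := by gcongr
  have h3 : 1 + x ^ 2 * (1 / (x + 1)) - x = 1 / (x + 1) := by field_simp; ring
  have : 0 < 1 / (x + 1) := by positivity
  rw [shapeInfo]
  linarith

lemma shapeInfoDeriv_nonpos {x : ℝ} (hx : 0 < x) : shapeInfoDeriv x ≤ 0 := by
  have h := mul_le_mul_of_nonneg_left (hurwitzTail_two_sub_le hx) (by positivity : 0 ≤ 2 * x)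
  have e : 2 * x * (1 / (2 * x)) = 1 := by field_simp
  rw [e] at h
  rw [shapeInfoDeriv]
  linarith

/-- The function `x³ ψ₁(x) - x²` is concave. -/
lemma two_mul_shapeInfoDeriv_add_nonpos {x : ℝ} (hx : 0 < x) :
    2 * shapeInfoDeriv x + x * shapeInfoDeriv₂ x ≤ 0 := by
  have h := mul_le_mul_of_nonneg_left (hurwitzTail_combination_le hx)
    (by positivity : 0 ≤ 6 * x)
  have e : 6 * x * (1 / (3 * x)) = 2 := by field_simp; norm_num
  rw [e] at h
  rw [shapeInfoDeriv, shapeInfoDeriv₂]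
  linarith

/-- The D-criterion needs elasticity above `3 - 2√3 ≈ -0.464`; `-2/5` is a convenient rational with
room to spare. -/
lemma neg_mul_shapeInfoDeriv_lt {x : ℝ} (hx : 0 < x) :
    -(x * shapeInfoDeriv x) < 2 / 5 * shapeInfo x := by
  have h2 := mul_le_mul_of_nonneg_left (le_hurwitzTail_two hx)
    (by positivity : 0 ≤ 12 / 5 * x ^ 2)
  have h3 := mul_le_mul_of_nonneg_left (hurwitzTail_three_le hx)
    (by positivity : 0 ≤ 2 * x ^ 3)
  obtain ⟨z, hz⟩ : ∃ z, z = x + 1 := ⟨_, rfl⟩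
  have hz0 : 0 < z := by linarith
  rw [← hz] at h2 h3
  -- This is `2/5 u + x u'` with the two series replaced by their bounds. In `z = x + 1` its
  -- numerator is a sum of squares plus a positive constant.
  have key : 12 / 5 * x ^ 2 * (1 / z + 1 / (2 * z ^ 2))
      - 2 * x ^ 3 * (1 / (2 * z ^ 2) + 1 / (2 * z ^ 3) + 1 / (4 * z ^ 4))
      - (7 / 5 * x - 2 / 5)
      = ((z ^ 2 - 5 / 4 * z) ^ 2 / 5 + 31 / 80 * (z - 20 / 31) ^ 2 + (1 / 2 - 5 / 31)) / z ^ 4 := by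
    rw [show x = z - 1 by linarith]
    field_simp
    ring
  have hpos : 0 < ((z ^ 2 - 5 / 4 * z) ^ 2 / 5 + 31 / 80 * (z - 20 / 31) ^ 2
      + (1 / 2 - 5 / 31)) / z ^ 4 := by
    have : (0 : ℝ) < 1 / 2 - 5 / 31 := by norm_num
    positivity
  rw [shapeInfo, shapeInfoDeriv]
  nlinarith

/-- The elasticity `x u'(x) / u(x)` of `u = shapeInfo`. -/
noncomputable def shapeElasticity (x : ℝ) : ℝ := x * shapeInfoDeriv x / shapeInfo x

lemma shapeElasticity_nonpos {x : ℝ} (hx : 0 < x) : shapeElasticity x ≤ 0 :=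
  div_nonpos_of_nonpos_of_nonneg (mul_nonpos_of_nonneg_of_nonpos hx.le (shapeInfoDeriv_nonpos hx))
    (shapeInfo_pos hx).le

lemma neg_two_fifths_lt_shapeElasticity {x : ℝ} (hx : 0 < x) : -(2 / 5) < shapeElasticity x := by
  rw [shapeElasticity, lt_div_iff₀ (shapeInfo_pos hx)]
  linarith [neg_mul_shapeInfoDeriv_lt hx]

/-- Exactly, `x s' = (x / u) (2u' + x u'') - s - s²`, and the bracket is `(x u)'' ≤ 0`. -/
lemma hasDerivAt_shapeElasticity {x : ℝ} (hx : 0 < x) :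
    ∃ s', HasDerivAt shapeElasticity s' x ∧
      x * s' ≤ -shapeElasticity x - shapeElasticity x ^ 2 := by
  have hu := shapeInfo_pos hx
  refine ⟨_, ((hasDerivAt_id x).mul (hasDerivAt_shapeInfoDeriv hx)).div
    (hasDerivAt_shapeInfo hx) hu.ne', ?_⟩
  simp only [id, Pi.mul_apply]
  have h := mul_nonpos_of_nonneg_of_nonpos (div_pos hx hu).le (two_mul_shapeInfoDeriv_add_nonpos hx)
  have e : x * (((1 * shapeInfoDeriv x + x * shapeInfoDeriv₂ x) * shapeInfo x
      - x * shapeInfoDeriv x * shapeInfoDeriv x) / shapeInfo x ^ 2)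
      = x / shapeInfo x * (2 * shapeInfoDeriv x + x * shapeInfoDeriv₂ x)
        + (-shapeElasticity x - shapeElasticity x ^ 2) := by
    rw [shapeElasticity]
    field_simp
    ring
  rw [e]
  linarith

/-! ### Elasticity of the efficiency -/

/-- The bounds on an elasticity `q` and its derivative from which the crossing properties with the
cost elasticities follow. -/
def ElasticityBound (q : ℝ → ℝ) : Prop :=
  ∀ x, 0 < x → ∃ q', HasDerivAt q q' x ∧
    (0 < q x → q x ≤ 1 ∧ 2 * (x * q') ≤ q x * (1 - q x ^ 2) ∧
      (q x < 1 → 2 * (x * q') < q x * (1 - q x ^ 2)))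

lemma elasticityBound_det : ElasticityBound fun x => (1 + shapeElasticity x) / 2 := by
  intro x hx
  obtain ⟨s', hs', hb⟩ := hasDerivAt_shapeElasticity hx
  have h1 := shapeElasticity_nonpos hx
  have h2 := neg_two_fifths_lt_shapeElasticity hx
  refine ⟨_, (hs'.const_add 1).div_const 2, fun _ => ?_⟩
  set s := shapeElasticity x
  have key : 2 * (x * (s' / 2)) < (1 + s) / 2 * (1 - ((1 + s) / 2) ^ 2) := by
    -- The difference of the two sides is `(1 + s)(3 + 6s - s²) / 8`; the quadratic factor is where
    -- the lower bound `-2/5` is spent.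
    have : -s - s ^ 2 < (1 + s) / 2 * (1 - ((1 + s) / 2) ^ 2) := by
      have h3 : 0 < 3 + 6 * s - s ^ 2 := by nlinarith
      nlinarith [mul_pos (by linarith : 0 < 1 + s) h3]
    linarith
  exact ⟨by linarith, key.le, fun _ => key⟩

/-- This `q` is the elasticity of `(A / u + B / x)⁻¹`, covering both A and V. The weight `A` may
vanish; then `q = 1` identically, which is why strictness in `ElasticityBound` is asked only when `q
< 1`. -/
lemma elasticityBound_weighted {A B : ℝ} (hA : 0 ≤ A) (hB : 0 < B) :
    ElasticityBound fun x =>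
      1 - A * x / (A * x + B * shapeInfo x) * (1 - shapeElasticity x) := by
  intro x hx
  obtain ⟨s', hs', hb⟩ := hasDerivAt_shapeElasticity hx
  have h1 := shapeElasticity_nonpos hx
  have hu := shapeInfo_pos hx
  have hden : 0 < A * x + B * shapeInfo x := by positivity
  have hw := ((hasDerivAt_id x).const_mul A).div
    (((hasDerivAt_id x).const_mul A).add ((hasDerivAt_shapeInfo hx).const_mul B)) hden.ne'
  refine ⟨_, (hw.mul (hs'.const_sub 1)).const_sub 1, fun hq => ?_⟩
  simp only [id, Pi.add_apply, Pi.div_apply] at hq ⊢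
  have hw' : x * ((A * 1 * (A * x + B * shapeInfo x)
      - A * x * (A * 1 + B * shapeInfoDeriv x)) / (A * x + B * shapeInfo x) ^ 2)
      = A * x / (A * x + B * shapeInfo x) * (1 - A * x / (A * x + B * shapeInfo x))
        * (1 - shapeElasticity x) := by
    rw [shapeElasticity]
    field_simp
    ring
  set w' := (A * 1 * (A * x + B * shapeInfo x)
      - A * x * (A * 1 + B * shapeInfoDeriv x)) / (A * x + B * shapeInfo x) ^ 2
  have hw0 : 0 ≤ A * x / (A * x + B * shapeInfo x) := by positivity
  set w := A * x / (A * x + B * shapeInfo x)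
  set s := shapeElasticity x
  have hz0 : 0 ≤ w * (1 - s) := mul_nonneg hw0 (by linarith)
  -- With `z = w (1 - s)`, the slack is `z (1 - z) (4 - z)` plus a multiple of `w` that is
  -- nonnegative by the bound on `x s'`. Here `0 ≤ z < 1` because `s ≤ 0` and `q = 1 - z > 0`.
  have e : (1 - w * (1 - s)) * (1 - (1 - w * (1 - s)) ^ 2)
      - 2 * (x * -(w' * (1 - s) + w * -s'))
      = w * (1 - s) * (1 - w * (1 - s)) * (4 - w * (1 - s))
        + 2 * w * ((-s - s ^ 2 - x * s') + 2 * s ^ 2) := by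
    have : x * -(w' * (1 - s) + w * -s') = -(x * w') * (1 - s) + w * (x * s') := by ring
    rw [this, hw']
    ring
  have e2 : 0 ≤ 2 * w * ((-s - s ^ 2 - x * s') + 2 * s ^ 2) :=
    mul_nonneg (by linarith) (by nlinarith [sq_nonneg s])
  have e3 : 0 ≤ w * (1 - s) * (1 - w * (1 - s)) * (4 - w * (1 - s)) :=
    mul_nonneg (mul_nonneg hz0 hq.le) (by linarith)
  refine ⟨by linarith, by linarith, fun hlt => ?_⟩
  have e4 : 0 < w * (1 - s) * (1 - w * (1 - s)) * (4 - w * (1 - s)) :=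
    mul_pos (mul_pos (by linarith) hq) (by linarith)
  linarith

/-! ### The three criteria -/

/-- The logarithm of the efficiency per observation as a function of the inspection interval. -/
noncomputable def logEff (η p α γ : ℝ) : Criterion → ℝ → ℝ
  | .D, τ => 1 / 2 * Real.log (α * τ ^ 3 * polygamma 1 (α * τ) - τ ^ 2)
  | .A, τ => -Real.log (1 / (τ ^ 2 * polygamma 1 (α * τ) - τ / α) + 1 / (α * τ))
  | .V, τ => -Real.log (h₁ η p α γ ^ 2 / (τ ^ 2 * polygamma 1 (α * τ) - τ / α)
        + h₂ η p α γ ^ 2 / (α * τ))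

lemma info_eq {α τ : ℝ} (hα : 0 < α) (hτ : 0 < τ) :
    τ ^ 2 * polygamma 1 (α * τ) - τ / α = shapeInfo (α * τ) / α ^ 2 := by
  rw [shapeInfo_eq (by positivity)]
  field_simp

lemma hasDerivAt_log_det {α τ : ℝ} (hα : 0 < α) (hτ : 0 < τ) :
    HasDerivAt (fun t : ℝ => Real.log (α * t ^ 3 * polygamma 1 (α * t) - t ^ 2))
      ((1 + shapeElasticity (α * τ)) / τ) τ := by
  have hx : 0 < α * τ := by positivity
  have hu := shapeInfo_pos hx
  have hd : HasDerivAt (fun t : ℝ => t * shapeInfo (α * t) / α)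
      ((1 * shapeInfo (α * τ) + τ * (shapeInfoDeriv (α * τ) * (α * 1))) / α) τ :=
    ((hasDerivAt_id τ).mul ((hasDerivAt_shapeInfo hx).comp τ
      ((hasDerivAt_id τ).const_mul α))).div_const α
  have h := hd.log (by positivity)
  refine (h.congr_deriv ?_).congr_of_eventuallyEq ?_
  · rw [shapeElasticity]
    field_simp
  · filter_upwards [lt_mem_nhds hτ] with t ht
    rw [shapeInfo_eq (by positivity)]
    congr 1
    field_simp

lemma hasDerivAt_log_weighted {a b α τ : ℝ} (ha : 0 ≤ a) (hb : 0 < b) (hα : 0 < α) (hτ : 0 < τ) :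
    HasDerivAt (fun t : ℝ => -Real.log (a / (t ^ 2 * polygamma 1 (α * t) - t / α) + b / (α * t)))
      ((1 - a * α ^ 2 * (α * τ) / (a * α ^ 2 * (α * τ) + b * shapeInfo (α * τ))
        * (1 - shapeElasticity (α * τ))) / τ) τ := by
  have hx : 0 < α * τ := by positivity
  have hu := shapeInfo_pos hx
  have hlin : HasDerivAt (fun t : ℝ => α * t) (α * 1) τ := (hasDerivAt_id τ).const_mul α
  have hd : HasDerivAt (fun t : ℝ => a * α ^ 2 / shapeInfo (α * t) + b / (α * t))
      ((0 * shapeInfo (α * τ) - a * α ^ 2 * (shapeInfoDeriv (α * τ) * (α * 1)))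
          / shapeInfo (α * τ) ^ 2
        + (0 * (α * τ) - b * (α * 1)) / (α * τ) ^ 2) τ :=
    ((hasDerivAt_const τ (a * α ^ 2)).div ((hasDerivAt_shapeInfo hx).comp τ hlin) hu.ne').add
      ((hasDerivAt_const τ b).div hlin hx.ne')
  have hpos : 0 < a * α ^ 2 / shapeInfo (α * τ) + b / (α * τ) := by positivity
  have h := (hd.log hpos.ne').neg
  have hden : 0 < a * α ^ 2 * (α * τ) + b * shapeInfo (α * τ) := by positivity
  refine (h.congr_deriv ?_).congr_of_eventuallyEq ?_
  · have e : a * α ^ 2 / shapeInfo (α * τ) + b / (α * τ)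
        = (a * α ^ 2 * (α * τ) + b * shapeInfo (α * τ)) / (shapeInfo (α * τ) * (α * τ)) := by
      field_simp
    rw [e, shapeElasticity]
    generalize shapeInfoDeriv (α * τ) = u' at *
    generalize shapeInfo (α * τ) = u at *
    field_simp
    ring
  · filter_upwards [lt_mem_nhds hτ] with t ht
    simp only [Pi.neg_apply]
    rw [info_eq hα ht, div_div_eq_mul_div]

/-- The elasticity of the efficiency; `φ(τ) = q(α τ) / τ`. -/
lemma exists_elasticity (crit : Criterion) {η p α γ : ℝ} (hα : 0 < α)
    (hh : crit = .V → h₂ η p α γ ≠ 0) :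
    ∃ q : ℝ → ℝ, ElasticityBound q ∧ ∀ τ, 0 < τ →
      HasDerivAt (logEff η p α γ crit) (phi η p α γ crit τ) τ ∧
      phi η p α γ crit τ = q (α * τ) / τ := by
  cases crit with
  | D =>
    refine ⟨_, elasticityBound_det, fun τ hτ => ?_⟩
    have h := hasDerivAt_log_det hα hτ
    have e : phi η p α γ .D τ = 1 / 2 * ((1 + shapeElasticity (α * τ)) / τ) := by
      rw [phi, h.deriv]
    refine ⟨?_, by rw [e]; ring⟩
    rw [e]
    exact h.const_mul _
  | A =>
    refine ⟨_, elasticityBound_weighted (A := 1 * α ^ 2) (B := 1) (by positivity) one_pos,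
      fun τ hτ => ?_⟩
    have h := hasDerivAt_log_weighted (a := 1) (b := 1) zero_le_one one_pos hα hτ
    have e := h.deriv
    rw [deriv.fun_neg] at e
    exact ⟨by rw [phi, e]; exact h, by rw [phi, e]⟩
  | V =>
    have hb : 0 < h₂ η p α γ ^ 2 := by have := hh rfl; positivity
    refine ⟨_, elasticityBound_weighted (A := h₁ η p α γ ^ 2 * α ^ 2) (by positivity) hb,
      fun τ hτ => ?_⟩
    have h := hasDerivAt_log_weighted (sq_nonneg (h₁ η p α γ)) hb hα hτ
    have e := h.deriv
    rw [deriv.fun_neg] at e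
    exact ⟨by rw [phi, e]; exact h, by rw [phi, e]⟩

/-- The exponent of the objective as a function of the total efficiency. -/
def Criterion.power : Criterion → ℝ
  | .D => 2
  | .A => 1
  | .V => 1

lemma Criterion.power_pos (crit : Criterion) : 0 < crit.power := by
  cases crit <;> simp [Criterion.power]

/-- The size `n m` factors out of the diagonal information matrix, entering the inverse determinant
squared and the other two criteria linearly; this fixes the exponent and the factor `1/2` in `φ_D`.
-/
lemma objective_eq (crit : Criterion) {η p α γ : ℝ} (hα : 0 < α)
    (hh : crit = .V → h₂ η p α γ ≠ 0) {ζ : Design} (hn : 0 < ζ.n) (hm : 0 < ζ.m)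
    (hτ : 0 < ζ.τ) :
    objective η p α γ crit ζ =
      Real.exp (-(crit.power * (Real.log (ζ.n * ζ.m) + logEff η p α γ crit ζ.τ))) := by
  obtain ⟨n, m, τ⟩ := ζ
  simp only at hn hm hτ ⊢
  have hx : 0 < α * τ := by positivity
  have hu := shapeInfo_pos hx
  have hI : fisherInfo α ⟨n, m, τ⟩ = Matrix.diagonal
      ![n * m * (shapeInfo (α * τ) / α ^ 2), n * m * (α * τ)] := by
    have := info_eq hα hτ
    ext i j
    fin_cases i <;> fin_cases j <;> simp [fisherInfo]
    · rw [← this]; ring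
    · ring
  have hinv : (fisherInfo α ⟨n, m, τ⟩)⁻¹ = Matrix.diagonal
      ![(n * m * (shapeInfo (α * τ) / α ^ 2))⁻¹, (n * m * (α * τ))⁻¹] := by
    rw [hI]
    apply Matrix.inv_eq_right_inv
    rw [Matrix.diagonal_mul_diagonal, ← Matrix.diagonal_one]
    congr 1
    ext i
    fin_cases i
    · exact mul_inv_cancel₀ (by positivity : n * m * (shapeInfo (α * τ) / α ^ 2) ≠ 0)
    · exact mul_inv_cancel₀ (by positivity : n * m * (α * τ) ≠ 0)
  have hnm : Real.exp (Real.log (n * m)) = n * m := Real.exp_log (by positivity)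
  cases crit with
  | D =>
    rw [objective, hinv, Matrix.det_diagonal, Fin.prod_univ_two]
    simp only [Criterion.power, logEff, Matrix.cons_val_zero, Matrix.cons_val_one]
    have e : α * τ ^ 3 * polygamma 1 (α * τ) - τ ^ 2 = τ * shapeInfo (α * τ) / α := by
      rw [shapeInfo_eq hx]; field_simp
    rw [e, show 2 * (Real.log (n * m) + 1 / 2 * Real.log (τ * shapeInfo (α * τ) / α))
      = Real.log (n * m) + Real.log (n * m) + Real.log (τ * shapeInfo (α * τ) / α) by ring,
      Real.exp_neg, Real.exp_add, Real.exp_add, hnm, Real.exp_log (by positivity)]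
    field_simp
  | A =>
    rw [objective, hinv, Matrix.trace_diagonal, Fin.sum_univ_two]
    simp only [Criterion.power, logEff, Matrix.cons_val_zero, Matrix.cons_val_one]
    rw [info_eq hα hτ, one_mul, neg_add, neg_neg, Real.exp_add, Real.exp_neg, hnm,
      Real.exp_log (by positivity)]
    field_simp
  | V =>
    have hb : 0 < h₂ η p α γ ^ 2 := by have := hh rfl; positivity
    rw [objective, hinv]
    simp only [Criterion.power, logEff]
    rw [info_eq hα hτ, one_mul, neg_add, neg_neg, Real.exp_add, Real.exp_neg, hnm,
      Real.exp_log (by positivity)]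
    simp [dotProduct, Matrix.mulVec_diagonal]
    field_simp

open MeasureTheory

/-! ### The regularized incomplete gamma function -/

/-- The upper incomplete gamma function. -/
noncomputable def upperGamma (a x : ℝ) : ℝ := ∫ y in Set.Ioi x, Real.exp (-y) * y ^ (a - 1)

/-- The regularized upper incomplete gamma function. -/
noncomputable def regGamma (a x : ℝ) : ℝ := upperGamma a x / Real.Gamma a

lemma integrableOn_gamma {a x : ℝ} (ha : 0 < a) (hx : 0 ≤ x) :
    IntegrableOn (fun y : ℝ => Real.exp (-y) * y ^ (a - 1)) (Set.Ioi x) :=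
  (Real.GammaIntegral_convergent ha).mono_set (Set.Ioi_subset_Ioi hx)

lemma hasDerivAt_upperGamma_right {a x : ℝ} (ha : 0 < a) (hx : 0 < x) :
    HasDerivAt (upperGamma a) (-(Real.exp (-x) * x ^ (a - 1))) x := by
  have hcont : ∀ y : ℝ, 0 < y → ContinuousAt (fun y : ℝ => Real.exp (-y) * y ^ (a - 1)) y :=
    fun y hy => (Real.continuous_exp.comp continuous_neg).continuousAt.mul
      (Real.continuousAt_rpow_const _ _ (Or.inl hy.ne'))
  have hx2 : (0 : ℝ) < x / 2 := by positivity
  have hint : IntervalIntegrable (fun y : ℝ => Real.exp (-y) * y ^ (a - 1)) volume (x / 2) x :=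
    ContinuousOn.intervalIntegrable fun y hy => by
      rw [Set.uIcc_of_le (by linarith)] at hy
      exact (hcont y (hx2.trans_le hy.1)).continuousWithinAt
  have hmeas : Measurable (fun y : ℝ => Real.exp (-y) * y ^ (a - 1)) := by fun_prop
  have h := (intervalIntegral.integral_hasDerivAt_right hint
    (hmeas.stronglyMeasurable.stronglyMeasurableAtFilter) (hcont x hx)).const_sub
      (upperGamma a (x / 2))
  refine h.congr_of_eventuallyEq ?_
  filter_upwards [lt_mem_nhds (by linarith : x / 2 < x)] with y hy
  rw [← intervalIntegral.integral_Ioi_sub_Ioi (integrableOn_gamma ha hx2.le) hy.le]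
  simp only [upperGamma]
  ring

lemma hasDerivAt_regGamma_right {a x : ℝ} (ha : 0 < a) (hx : 0 < x) :
    HasDerivAt (regGamma a) (-(Real.exp (-x) * x ^ (a - 1)) / Real.Gamma a) x :=
  (hasDerivAt_upperGamma_right ha hx).div_const _

lemma differentiableAt_Gamma_of_pos {a : ℝ} (ha : 0 < a) : DifferentiableAt ℝ Real.Gamma a :=
  Real.differentiableAt_Gamma fun m => by
    have : (0 : ℝ) ≤ m := m.cast_nonneg
    linarith

/-- The upper incomplete gamma function is `x ^ (a - 1)` times this scaled integral. -/
noncomputable def scaledUpper (x a : ℝ) : ℝ := ∫ y in Set.Ioi x, (y / x) ^ (a - 1) * Real.exp (-y)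

lemma integrableOn_scaled {a x : ℝ} (ha : 0 < a) (hx : 0 < x) :
    IntegrableOn (fun y : ℝ => (y / x) ^ (a - 1) * Real.exp (-y)) (Set.Ioi 0) := by
  refine IntegrableOn.congr_fun ((Real.GammaIntegral_convergent ha).mul_const ((x ^ (a - 1))⁻¹))
    (fun y hy => ?_) measurableSet_Ioi
  have hy' : 0 < y := hy
  rw [Real.div_rpow hy'.le hx.le]
  field_simp

lemma upperGamma_eq_mul_scaledUpper {a x : ℝ} (hx : 0 < x) :
    upperGamma a x = x ^ (a - 1) * scaledUpper x a := by
  rw [upperGamma, scaledUpper, ← integral_const_mul]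
  refine setIntegral_congr_fun measurableSet_Ioi fun y hy => ?_
  have hy' : 0 < y := hx.trans hy
  have := Real.rpow_pos_of_pos hx (a - 1)
  rw [Real.div_rpow hy'.le hx.le]
  field_simp

lemma scaledUpper_nonneg {x a : ℝ} (hx : 0 < x) : 0 ≤ scaledUpper x a :=
  setIntegral_nonneg measurableSet_Ioi fun y hy => by
    have hy' : 0 < y := hx.trans hy
    positivity

/-- The scaling puts the base `y / x` above `1` on the ray, so the derivative of the integrand in
the exponent is positive. -/
lemma hasDerivAt_scaledUpper {x a : ℝ} (hx : 0 < x) (ha : 0 < a) :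
    ∃ d, 0 < d ∧ HasDerivAt (scaledUpper x) d a := by
  have hb : IntegrableOn (fun y : ℝ => (y / x) ^ (a + 2 - 1) * Real.exp (-y)) (Set.Ioi x) :=
    (integrableOn_scaled (by linarith) hx).mono_set (Set.Ioi_subset_Ioi hx.le)
  have hpos : ∀ y ∈ Set.Ioi x, ∀ b : ℝ,
      0 < (y / x) ^ (b - 1) * Real.log (y / x) * Real.exp (-y) := by
    intro y hy b
    have h1 : 1 < y / x := by rwa [one_lt_div hx]
    have := Real.log_pos h1
    positivity
  obtain ⟨hi, hd⟩ := hasDerivAt_integral_of_dominated_loc_of_deriv_le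
    (μ := volume.restrict (Set.Ioi x)) (x₀ := a) (s := Metric.ball a 1)
    (F := fun b y => (y / x) ^ (b - 1) * Real.exp (-y))
    (F' := fun b y => (y / x) ^ (b - 1) * Real.log (y / x) * Real.exp (-y))
    -- For `b < a + 1` and `r = y / x > 1` one has `r^(b-1) log r ≤ r^a · r`; writing the exponent
    -- as `a + 2 - 1` makes this the integrand of shape `a + 2`.
    (bound := fun y => (y / x) ^ (a + 2 - 1) * Real.exp (-y))
    (Metric.ball_mem_nhds _ one_pos)
    (Eventually.of_forall fun b => by
      have : Measurable fun y : ℝ => (y / x) ^ (b - 1) * Real.exp (-y) := by fun_prop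
      exact this.aestronglyMeasurable)
    ((integrableOn_scaled ha hx).mono_set (Set.Ioi_subset_Ioi hx.le))
    (by
      have : Measurable fun y : ℝ => (y / x) ^ (a - 1) * Real.log (y / x) * Real.exp (-y) := by
        fun_prop
      exact this.aestronglyMeasurable)
    (by
      refine (ae_restrict_iff' measurableSet_Ioi).mpr (Eventually.of_forall fun y hy b hb => ?_)
      have h1 : 1 < y / x := by rwa [one_lt_div hx]
      have h0 : 0 < y / x := by linarith
      rw [Real.norm_of_nonneg (hpos y hy b).le]
      have hb' : b < a + 1 := by
        rw [Metric.mem_ball, Real.dist_eq] at hb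
        linarith [(abs_lt.mp hb).2]
      have h2 : Real.log (y / x) ≤ y / x := (Real.log_le_sub_one_of_pos h0).trans (by linarith)
      have h3 : (y / x) ^ (b - 1) ≤ (y / x) ^ a :=
        Real.rpow_le_rpow_of_exponent_le h1.le (by linarith)
      have h4 : (y / x) ^ (a + 2 - 1) = (y / x) ^ a * (y / x) := by
        rw [show a + 2 - 1 = a + 1 by ring, Real.rpow_add_one h0.ne']
      rw [h4]
      have := (Real.log_pos h1).le
      gcongr)
    hb
    (by
      refine (ae_restrict_iff' measurableSet_Ioi).mpr (Eventually.of_forall fun y hy b hb => ?_)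
      have h0 : 0 < y / x := div_pos (hx.trans hy) hx
      have h := ((((hasDerivAt_id b).sub_const 1).const_rpow h0).mul_const (Real.exp (-y)))
      refine h.congr_deriv ?_
      simp only [id]
      ring)
  refine ⟨_, ?_, hd⟩
  rw [setIntegral_pos_iff_support_of_nonneg_ae]
  · have : Function.support (fun y => (y / x) ^ (a - 1) * Real.log (y / x) * Real.exp (-y))
        ∩ Set.Ioi x = Set.Ioi x :=
      Set.inter_eq_right.mpr fun y hy => (hpos y hy a).ne'
    rw [this, Real.volume_Ioi]
    exact ENNReal.zero_lt_top
  · exact (ae_restrict_iff' measurableSet_Ioi).mpr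
      (Eventually.of_forall fun y hy => (hpos y hy a).le)
  · exact hi

/-- The lower part of the scaled Gamma integral. -/
noncomputable def scaledLower (x a : ℝ) : ℝ :=
  ∫ y in Set.Ioc 0 x, (y / x) ^ (a - 1) * Real.exp (-y)

lemma integrableOn_scaled_Ioc {a x : ℝ} (ha : 0 < a) (hx : 0 < x) :
    IntegrableOn (fun y : ℝ => (y / x) ^ (a - 1) * Real.exp (-y)) (Set.Ioc 0 x) :=
  (integrableOn_scaled ha hx).mono_set Set.Ioc_subset_Ioi_self

lemma scaledLower_add_scaledUpper {a x : ℝ} (ha : 0 < a) (hx : 0 < x) :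
    scaledLower x a + scaledUpper x a = Real.Gamma a / x ^ (a - 1) := by
  rw [scaledLower, scaledUpper, ← setIntegral_union (Set.Ioc_disjoint_Ioi le_rfl)
    measurableSet_Ioi (integrableOn_scaled_Ioc ha hx)
    ((integrableOn_scaled ha hx).mono_set (Set.Ioi_subset_Ioi hx.le)),
    Set.Ioc_union_Ioi_eq_Ioi hx.le, Real.Gamma_eq_integral ha, ← integral_div]
  refine setIntegral_congr_fun measurableSet_Ioi fun y hy => ?_
  have hy' : 0 < y := hy
  rw [Real.div_rpow hy'.le hx.le]
  ring

lemma scaledLower_pos {a x : ℝ} (ha : 0 < a) (hx : 0 < x) : 0 < scaledLower x a := by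
  have hpos : ∀ y ∈ Set.Ioc 0 x, 0 < (y / x) ^ (a - 1) * Real.exp (-y) := fun y hy => by
    have hy' : 0 < y := hy.1
    positivity
  rw [scaledLower, setIntegral_pos_iff_support_of_nonneg_ae]
  · have : Function.support (fun y => (y / x) ^ (a - 1) * Real.exp (-y)) ∩ Set.Ioc 0 x
        = Set.Ioc 0 x := Set.inter_eq_right.mpr fun y hy => (hpos y hy).ne'
    rw [this, Real.volume_Ioc]
    simpa using hx
  · exact (ae_restrict_iff' measurableSet_Ioc).mpr (Eventually.of_forall fun y hy => (hpos y hy).le)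
  · exact integrableOn_scaled_Ioc ha hx

/-- Below `x` the base `y / x` is at most `1`, so the same scaling moves the lower part the opposite
way. Both facts together make the upper fraction increase with the shape. -/
lemma antitoneOn_scaledLower {x : ℝ} (hx : 0 < x) : AntitoneOn (scaledLower x) (Set.Ioi 0) := by
  intro a ha b hb hab
  refine setIntegral_mono_on (integrableOn_scaled_Ioc hb hx) (integrableOn_scaled_Ioc ha hx)
    measurableSet_Ioc fun y hy => ?_
  have hy' : 0 < y := hy.1
  gcongr ?_ * _
  exact Real.rpow_le_rpow_of_exponent_ge (by positivity) ((div_le_one hx).mpr hy.2) (by linarith)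

lemma regGamma_eq_div {a x : ℝ} (ha : 0 < a) (hx : 0 < x) :
    regGamma a x = scaledUpper x a / (scaledLower x a + scaledUpper x a) := by
  have h1 := Real.rpow_pos_of_pos hx (a - 1)
  have h2 := Real.Gamma_pos_of_pos ha
  rw [regGamma, upperGamma_eq_mul_scaledUpper hx, scaledLower_add_scaledUpper ha hx]
  field_simp

/-- The regularized upper incomplete gamma function increases with the shape. -/
lemma hasDerivAt_regGamma_left {a x : ℝ} (ha : 0 < a) (hx : 0 < x) :
    ∃ d, 0 < d ∧ HasDerivAt (fun b => regGamma b x) d a := by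
  obtain ⟨d, hd0, hd⟩ := hasDerivAt_scaledUpper hx ha
  -- Differentiability of the lower part is inherited from `Γ` and the upper part, and the sign of
  -- its derivative from monotonicity; no differentiation under the integral near `0` is needed.
  have hev : scaledLower x =ᶠ[𝓝 a] fun b => Real.Gamma b / x ^ (b - 1) - scaledUpper x b := by
    filter_upwards [lt_mem_nhds ha] with b hb
    rw [← scaledLower_add_scaledUpper hb hx]
    ring
  have hdL : DifferentiableAt ℝ (scaledLower x) a := by
    refine DifferentiableAt.congr_of_eventuallyEq ?_ hev
    refine DifferentiableAt.fun_sub (DifferentiableAt.fun_div (differentiableAt_Gamma_of_pos ha) ?_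
      (Real.rpow_pos_of_pos hx _).ne') hd.differentiableAt
    exact (((hasDerivAt_id a).sub_const 1).const_rpow hx).differentiableAt
  obtain ⟨e, he⟩ : ∃ e, HasDerivAt (scaledLower x) e a := ⟨_, hdL.hasDerivAt⟩
  have he0 : e ≤ 0 := by
    have := (antitoneOn_scaledLower hx).derivWithin_nonpos (x := a)
    rwa [he.hasDerivWithinAt.derivWithin (isOpen_Ioi.uniqueDiffWithinAt ha)] at this
  have hL := scaledLower_pos ha hx
  have hU := scaledUpper_nonneg (a := a) hx
  have hne : scaledLower x a + scaledUpper x a ≠ 0 := by positivity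
  refine ⟨_, ?_, (hd.div (he.add hd) hne).congr_of_eventuallyEq ?_⟩
  · have : d * (scaledLower x + scaledUpper x) a - scaledUpper x a * (e + d)
        = d * scaledLower x a + scaledUpper x a * -e := by
      simp only [Pi.add_apply]
      ring
    rw [this]
    have : 0 ≤ scaledUpper x a * -e := mul_nonneg hU (by linarith)
    have h3 : (0 : ℝ) < (scaledLower x + scaledUpper x) a := by
      simp only [Pi.add_apply]; positivity
    positivity
  · filter_upwards [lt_mem_nhds ha] with b hb
    rw [regGamma_eq_div hb hx]
    rfl

lemma strictMonoOn_regGamma {x : ℝ} (hx : 0 < x) :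
    StrictMonoOn (fun a => regGamma a x) (Set.Ioi 0) := by
  refine strictMonoOn_of_deriv_pos (convex_Ioi 0) (fun a ha => ?_) fun a ha => ?_
  · obtain ⟨d, -, hd⟩ := hasDerivAt_regGamma_left ha hx
    exact hd.continuousAt.continuousWithinAt
  · rw [interior_Ioi] at ha
    obtain ⟨d, hd0, hd⟩ := hasDerivAt_regGamma_left ha hx
    rwa [hd.deriv]

/-- As the shape tends to `0`, `Γ a = Γ (a + 1) / a` blows up while the upper integral stays
bounded. -/
lemma exists_regGamma_lt {x p : ℝ} (hx : 0 < x) (hp : 0 < p) : ∃ a, 0 < a ∧ regGamma a x < p := by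
  have hlim : ContinuousAt (fun a : ℝ => a * x ^ (a - 1) / Real.Gamma (a + 1)) 0 := by
    refine (continuousAt_id.mul ?_).div ?_ ?_
    · exact (((hasDerivAt_id (0 : ℝ)).sub_const 1).const_rpow hx).continuousAt
    · exact ContinuousAt.comp (g := Real.Gamma) (f := fun a : ℝ => a + 1)
        (differentiableAt_Gamma_of_pos (by norm_num)).continuousAt (by fun_prop)
    · simp
  have h1 : ∀ᶠ a in 𝓝 (0 : ℝ), a * x ^ (a - 1) / Real.Gamma (a + 1) < p :=
    hlim.eventually (gt_mem_nhds (by simpa using hp))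
  have h2 : ∀ᶠ a in 𝓝 (0 : ℝ), a < 1 := gt_mem_nhds one_pos
  obtain ⟨a, ⟨ha1, ha2⟩, ha0⟩ := (((h1.and h2).filter_mono nhdsWithin_le_nhds).and
    (self_mem_nhdsWithin : Set.Ioi (0 : ℝ) ∈ 𝓝[>] 0)).exists
  have ha0' : 0 < a := ha0
  refine ⟨a, ha0, lt_of_le_of_lt ?_ ha1⟩
  rw [regGamma, upperGamma_eq_mul_scaledUpper hx, Real.Gamma_add_one ha0'.ne']
  have hV : scaledUpper x a ≤ 1 := by
    have : scaledUpper x a ≤ ∫ y in Set.Ioi x, Real.exp (-y) := by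
      refine setIntegral_mono_on
        ((integrableOn_scaled ha0 hx).mono_set (Set.Ioi_subset_Ioi hx.le))
        (integrableOn_exp_neg_Ioi x) measurableSet_Ioi fun y hy => ?_
      have h1 : 1 < y / x := by rwa [one_lt_div hx]
      have := Real.rpow_le_one_of_one_le_of_nonpos h1.le (by linarith : a - 1 ≤ 0)
      exact mul_le_of_le_one_left (Real.exp_pos _).le this
    rw [integral_exp_neg_Ioi] at this
    exact this.trans (by simpa using hx.le)
  have hG := Real.Gamma_pos_of_pos ha0'
  have hX := Real.rpow_pos_of_pos hx (a - 1)
  rw [mul_div_mul_left _ _ ha0'.ne']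
  gcongr
  exact mul_le_of_le_one_right hX.le hV

/-- At integer shape `n` the missing lower fraction is at most `xⁿ / n!`, which tends to `0`. -/
lemma exists_lt_regGamma {x p : ℝ} (hx : 0 < x) (hp : p < 1) : ∃ a, 0 < a ∧ p < regGamma a x := by
  have h1 := (FloorSemiring.tendsto_pow_div_factorial_atTop x).eventually
    (gt_mem_nhds (by linarith : (0 : ℝ) < 1 - p))
  obtain ⟨n, hn, hn1⟩ := (h1.and (eventually_ge_atTop 1)).exists
  have hn0 : (0 : ℝ) < n := by exact_mod_cast hn1
  refine ⟨n, hn0, ?_⟩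
  have hsub := intervalIntegral.integral_Ioi_sub_Ioi (integrableOn_gamma hn0 le_rfl) hx.le
  rw [← Real.Gamma_eq_integral hn0] at hsub
  have hle : ∫ y in (0 : ℝ)..x, Real.exp (-y) * y ^ ((n : ℝ) - 1) ≤ x ^ n / n := by
    have e : ∫ y in (0 : ℝ)..x, y ^ ((n : ℝ) - 1) = x ^ n / n := by
      rw [integral_rpow (Or.inl (by linarith))]
      simp [Real.zero_rpow hn0.ne']
    rw [← e]
    refine intervalIntegral.integral_mono_on hx.le ?_
      (intervalIntegral.intervalIntegrable_rpow' (by linarith)) fun y hy => ?_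
    · rw [intervalIntegrable_iff_integrableOn_Ioc_of_le hx.le]
      exact (integrableOn_gamma hn0 le_rfl).mono_set Set.Ioc_subset_Ioi_self
    · exact mul_le_of_le_one_left (Real.rpow_nonneg hy.1 _) (by simpa using hy.1)
  have hG := Real.Gamma_pos_of_pos hn0
  have hfac : (n.factorial : ℝ) = n * Real.Gamma n := by
    rw [← Real.Gamma_nat_eq_factorial, Real.Gamma_add_one hn0.ne']
  have hU : Real.Gamma n - x ^ n / n ≤ upperGamma n x := by
    rw [upperGamma]; linarith
  have h3 : 1 - x ^ n / n.factorial ≤ regGamma n x := by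
    have : 1 - x ^ n / n.factorial = (Real.Gamma n - x ^ n / n) / Real.Gamma n := by
      rw [hfac]; field_simp
    rw [this, regGamma]
    gcongr
  linarith

lemma exists_regGamma_eq {x p : ℝ} (hx : 0 < x) (hp₀ : 0 < p) (hp₁ : p < 1) :
    ∃ a, 0 < a ∧ regGamma a x = p := by
  obtain ⟨a, ha, hap⟩ := exists_regGamma_lt hx hp₀
  obtain ⟨b, hb, hbp⟩ := exists_lt_regGamma hx hp₁
  have hcont : ContinuousOn (fun a => regGamma a x) (Set.Ioi 0) := fun a ha => by
    obtain ⟨d, -, hd⟩ := hasDerivAt_regGamma_left ha hx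
    exact hd.continuousAt.continuousWithinAt
  obtain ⟨c, hc, hcp⟩ := isPreconnected_Ioi.intermediate_value (a := a) (b := b) ha hb hcont
    ⟨hap.le, hbp.le⟩
  exact ⟨c, hc, hcp⟩

/-! ### The quantile of the lifetime -/

lemma lifetimeCDF_eq_regGamma {η α γ t : ℝ} (hη : 0 < η) (hα : 0 < α) (ht : 0 < t) :
    lifetimeCDF η α γ t = regGamma (α * t) (α * Real.exp (-γ) * η) := by
  have ha : 0 < α * t := by positivity
  have hr : 0 < α * Real.exp (-γ) := by positivity
  set a := α * t
  set r := α * Real.exp (-γ)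
  rw [lifetimeCDF, gammaMeasure, measureReal_def, withDensity_apply _ measurableSet_Ici]
  simp only [gammaPDF]
  rw [← integral_eq_lintegral_of_nonneg_ae
    (Eventually.of_forall fun y => gammaPDFReal_nonneg ha hr y)
    (measurable_gammaPDFReal a r).aestronglyMeasurable, integral_Ici_eq_integral_Ioi]
  have h := integral_comp_mul_left_Ioi (fun z : ℝ => Real.exp (-z) * z ^ (a - 1)) η hr
  have hr1 := Real.rpow_pos_of_pos hr (a - 1)
  have e : ∫ y in Set.Ioi η, gammaPDFReal a r y
      = r / Real.Gamma a * ∫ y in Set.Ioi η, Real.exp (-(r * y)) * (r * y) ^ (a - 1) := by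
    rw [← integral_const_mul]
    refine setIntegral_congr_fun measurableSet_Ioi fun y hy => ?_
    have hy0 : 0 < y := hη.trans hy
    simp only [gammaPDFReal, if_pos hy0.le]
    have : r ^ a = r * r ^ (a - 1) := by
      rw [mul_comm, ← Real.rpow_add_one hr.ne', sub_add_cancel]
    rw [Real.mul_rpow hr.le hy0.le, this]
    ring
  rw [e, h, regGamma, upperGamma, smul_eq_mul]
  field_simp

lemma lifetimeQuantile_eq {η p α γ s : ℝ} (hη : 0 < η) (hα : 0 < α) (hs : 0 < s)
    (hsp : regGamma s (α * Real.exp (-γ) * η) = p) : lifetimeQuantile η p α γ = s / α := by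
  have hx : 0 < α * Real.exp (-γ) * η := by positivity
  have : {t : ℝ | 0 < t ∧ p ≤ lifetimeCDF η α γ t} = Set.Ici (s / α) := by
    ext t
    simp only [Set.mem_ofPred_eq, Set.mem_Ici]
    constructor
    · rintro ⟨ht, hpt⟩
      rw [lifetimeCDF_eq_regGamma hη hα ht, ← hsp] at hpt
      have := ((strictMonoOn_regGamma hx).le_iff_le hs (mul_pos hα ht)).mp hpt
      rwa [div_le_iff₀' hα]
    · intro h
      have ht : 0 < t := (div_pos hs hα).trans_le h
      refine ⟨ht, ?_⟩
      rw [lifetimeCDF_eq_regGamma hη hα ht, ← hsp]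
      refine ((strictMonoOn_regGamma hx).le_iff_le hs (mul_pos hα ht)).mpr ?_
      rwa [div_le_iff₀' hα] at h
  rw [lifetimeQuantile, this, csInf_Ici]

/-- The implicit function `s` with `regGamma (s x) x = p` has a positive derivative. -/
lemma exists_implicit_hasDerivAt {p x₀ : ℝ} {s : ℝ → ℝ} (hx₀ : 0 < x₀)
    (hs : ∀ x, 0 < x → 0 < s x) (hsp : ∀ x, 0 < x → regGamma (s x) x = p) :
    ∃ d, d ≠ 0 ∧ HasDerivAt s d x₀ := by
  have hs0 := hs x₀ hx₀
  have hxpos : ∀ᶠ x in 𝓝 x₀, 0 < x := lt_mem_nhds hx₀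
  -- A strict inequality between `p` and `regGamma b x₀` persists for nearby `x`; monotonicity in
  -- the shape converts it into a bound on `s x`.
  have hcont : ContinuousAt s x₀ := by
    rw [ContinuousAt, tendsto_order]
    constructor
    · intro b hb
      by_cases hb0 : b ≤ 0
      · filter_upwards [hxpos] with x hx using hb0.trans_lt (hs x hx)
      · push Not at hb0
        have h1 : regGamma b x₀ < p := by
          rw [← hsp x₀ hx₀]; exact strictMonoOn_regGamma hx₀ hb0 hs0 hb
        filter_upwards [hxpos, (hasDerivAt_regGamma_right hb0 hx₀).continuousAt.eventually
          (gt_mem_nhds h1)] with x hx h2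
        rw [← hsp x hx] at h2
        exact ((strictMonoOn_regGamma hx).lt_iff_lt hb0 (hs x hx)).mp h2
    · intro b hb
      have hb0 : 0 < b := hs0.trans hb
      have h1 : p < regGamma b x₀ := by
        rw [← hsp x₀ hx₀]; exact strictMonoOn_regGamma hx₀ hs0 hb0 hb
      filter_upwards [hxpos, (hasDerivAt_regGamma_right hb0 hx₀).continuousAt.eventually
        (lt_mem_nhds h1)] with x hx h2
      rw [← hsp x hx] at h2
      exact ((strictMonoOn_regGamma hx).lt_iff_lt (hs x hx) hb0).mp h2
  obtain ⟨d, hd0, hd⟩ := hasDerivAt_regGamma_left hs0 hx₀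
  set f : ℝ × ℝ → ℝ := fun z => Real.exp (-z.2) * z.2 ^ (z.1 - 1) / Real.Gamma z.1 with hf
  have hfc : ContinuousAt f (s x₀, x₀) := by
    refine ContinuousAt.div ?_ ?_ (Real.Gamma_pos_of_pos hs0).ne'
    · refine ContinuousAt.mul (by fun_prop) (ContinuousAt.rpow (by fun_prop) (by fun_prop) ?_)
      exact Or.inl hx₀.ne'
    · exact ContinuousAt.comp (g := Real.Gamma) (f := Prod.fst)
        (differentiableAt_Gamma_of_pos hs0).continuousAt continuousAt_fst
  set b := f (s x₀, x₀) with hb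
  have hb0 : 0 < b := by
    have := Real.Gamma_pos_of_pos hs0
    simp only [hb, hf]
    positivity
  -- Since `regGamma (s x) x = p`, the increment is minus a change in the second argument alone. The
  -- mean value inequality there, uniform in the shape by joint continuity of the density, replaces
  -- joint differentiability.
  have hB : HasDerivAt (fun x => regGamma (s x) x₀) b x₀ := by
    rw [hasDerivAt_iff_isLittleO, Asymptotics.isLittleO_iff]
    intro ε hε
    have hev : ∀ᶠ z in 𝓝 (s x₀) ×ˢ 𝓝 x₀, ‖f z - b‖ < ε := by
      have := hfc.eventually (Metric.ball_mem_nhds b hε)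
      rw [nhds_prod_eq] at this
      filter_upwards [this] with z hz
      rwa [← dist_eq_norm]
    obtain ⟨P, hP, R, hR, hPR⟩ := Filter.eventually_prod_iff.mp hev
    obtain ⟨r, hr, hball⟩ := Metric.eventually_nhds_iff_ball.mp (hR.and hxpos)
    filter_upwards [hcont.eventually hP, Metric.ball_mem_nhds x₀ hr, hxpos] with x hPx hxr hx
    have hmv := Convex.norm_image_sub_le_of_norm_hasDerivWithin_le (s := Metric.ball x₀ r)
      (f := fun y => regGamma (s x) y + b * y) (f' := fun y => -f (s x, y) + b * 1) (C := ε)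
      (x := x₀) (y := x)
      (fun y hy => by
        have h := ((hasDerivAt_regGamma_right (hs x hx) (hball y hy).2).add
          ((hasDerivAt_id y).const_mul b)).hasDerivWithinAt (s := Metric.ball x₀ r)
        refine h.congr_deriv ?_
        simp only [hf, neg_div])
      (fun y hy => by
        have := hPR hPx (hball y hy).1
        rw [← norm_neg]
        refine le_of_eq_of_le ?_ this.le
        congr 1
        ring)
      (convex_ball _ _) (Metric.mem_ball_self hr) hxr
    rw [← norm_neg]
    refine le_of_eq_of_le ?_ hmv
    congr 1
    rw [hsp x₀ hx₀, hsp x hx, smul_eq_mul]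
    ring
  refine ⟨b / d, (div_pos hb0 hd0).ne', ?_⟩
  have hBO := hB.isBigO_sub
  -- The nonzero shape derivative bounds the increment of `s` by that of `regGamma (s x) x₀`, which
  -- `hB` makes linear in `x - x₀`. The error of the shape linearisation is then negligible against
  -- `x - x₀`.
  have hdO : (fun x => s x - s x₀) =O[𝓝 x₀] fun x => x - x₀ := by
    have h1 := (HasDerivAtFilter.isTheta_sub hd hd0.ne').2
    have h2 : Tendsto (fun x => (s x, s x₀)) (𝓝 x₀) (𝓝 (s x₀) ×ˢ pure (s x₀)) :=
      Tendsto.prodMk hcont (tendsto_pure.mpr (Eventually.of_forall fun _ => rfl))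
    exact (h1.comp_tendsto h2).trans hBO
  have h1 := (hasDerivAt_iff_isLittleO.mp hd).comp_tendsto hcont
  have h2 := h1.trans_isBigO hdO
  have h3 := hasDerivAt_iff_isLittleO.mp hB
  rw [hasDerivAt_iff_isLittleO]
  refine ((h3.sub h2).const_mul_left d⁻¹).congr_left fun x => ?_
  simp only [Function.comp_apply, smul_eq_mul]
  field_simp
  ring

/-- The quantile of the lifetime is not stationary in `γ`. -/
lemma h₂_ne_zero {η p α γ : ℝ} (hη : 0 < η) (hp₀ : 0 < p) (hp₁ : p < 1) (hα : 0 < α) :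
    h₂ η p α γ ≠ 0 := by
  have hex : ∀ x : ℝ, ∃ a, 0 < x → 0 < a ∧ regGamma a x = p := fun x => by
    by_cases hx : 0 < x
    · obtain ⟨a, ha⟩ := exists_regGamma_eq hx hp₀ hp₁
      exact ⟨a, fun _ => ha⟩
    · exact ⟨0, fun h => absurd h hx⟩
  choose s hs using hex
  have hx₀ : 0 < α * Real.exp (-γ) * η := by positivity
  obtain ⟨d, hd0, hd⟩ := exists_implicit_hasDerivAt hx₀ (fun x hx => (hs x hx).1)
    (fun x hx => (hs x hx).2)
  have hq : (fun g => lifetimeQuantile η p α g) = fun g => s (α * Real.exp (-g) * η) / α := by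
    ext g
    have hx : 0 < α * Real.exp (-g) * η := by positivity
    exact lifetimeQuantile_eq hη hα (hs _ hx).1 (hs _ hx).2
  have hinner : HasDerivAt (fun g : ℝ => α * Real.exp (-g) * η)
      (α * (Real.exp (-γ) * -1) * η) γ :=
    (((hasDerivAt_neg γ).exp).const_mul α).mul_const η
  have h := (HasDerivAt.comp γ hd hinner).div_const α
  rw [h₂, hq]
  have e := h.deriv
  simp only [Function.comp_def] at e
  rw [e]
  have := Real.exp_pos (-γ)
  refine div_ne_zero (mul_ne_zero hd0 (mul_ne_zero (mul_ne_zero hα.ne' ?_) hη.ne')) hα.ne'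
  exact mul_ne_zero this.ne' (by norm_num)

/-! ### Single crossing -/

/-- A fencing argument keeps `f ≤ 0`. Equality at `b` would make the left difference quotients
nonnegative, contradicting a negative derivative there. -/
lemma neg_of_hasDerivAt_neg_of_eq_zero {f : ℝ → ℝ} {a b : ℝ} (hab : a < b)
    (hd : ∀ x ∈ Set.Icc a b, ∃ f', HasDerivAt f f' x ∧ (f x = 0 → f' < 0)) (ha : f a ≤ 0) :
    f b < 0 := by
  choose! f' hf' hz using hd
  have hle : ∀ x ∈ Set.Icc a b, f x ≤ 0 := by
    have h := image_le_of_deriv_right_lt_deriv_boundary (f := f) (f' := f') (a := a) (b := b)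
      (B := fun _ => 0) (B' := fun _ => 0)
      (fun x hx => (hf' x hx).continuousAt.continuousWithinAt)
      (fun x hx => (hf' x (Set.Ico_subset_Icc_self hx)).hasDerivWithinAt) ha
      (fun x => hasDerivAt_const x 0) (fun x hx => hz x (Set.Ico_subset_Icc_self hx))
    exact fun x hx => h hx
  have hb : b ∈ Set.Icc a b := Set.right_mem_Icc.mpr hab.le
  refine lt_of_le_of_ne (hle b hb) fun h0 => ?_
  have hneg := hz b hb h0
  have hslope := (hasDerivAt_iff_tendsto_slope.mp (hf' b hb)).mono_left
    (nhdsWithin_mono b (fun x (hx : x < b) => hx.ne) : 𝓝[<] b ≤ 𝓝[≠] b)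
  have hge : 0 ≤ f' b := by
    refine ge_of_tendsto hslope ?_
    filter_upwards [Ioo_mem_nhdsLT hab] with x hx
    rw [slope_def_field, h0, sub_zero]
    exact div_nonneg_of_nonpos (hle x ⟨hx.1.le, hx.2.le⟩) (by linarith [hx.2])
  linarith

/-- Once `φ` is at most `k`, it stays below `k`. -/
def CrossesDown (φ k : ℝ → ℝ) (S : Set ℝ) : Prop :=
  ∀ s ∈ S, ∀ t ∈ S, s < t → φ s ≤ k s → φ t < k t

lemma CrossesDown.mono {φ k : ℝ → ℝ} {S T : Set ℝ} (h : CrossesDown φ k T) (hST : S ⊆ T) :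
    CrossesDown φ k S :=
  fun s hs t ht => h s (hST hs) t (hST ht)

/-- When the two points straddle the junction, the inequality is carried to `e` along `k₁`, changed
to `k₂` by the common value, and carried on. -/
lemma CrossesDown.ite {φ k₁ k₂ : ℝ → ℝ} {S : Set ℝ} (hS : S.OrdConnected) {e : ℝ}
    (h₁ : CrossesDown φ k₁ S) (h₂ : CrossesDown φ k₂ S) (he : k₁ e = k₂ e) :
    CrossesDown φ (fun x => if x ≤ e then k₁ x else k₂ x) S := by
  intro s hs t ht hst h
  simp only at h ⊢
  by_cases h1 : t ≤ e
  · rw [if_pos h1]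
    rw [if_pos (hst.le.trans h1)] at h
    exact h₁ s hs t ht hst h
  · rw [if_neg h1]
    push Not at h1
    by_cases h2 : s ≤ e
    · rw [if_pos h2] at h
      have heS : e ∈ S := hS.out hs ht ⟨h2, h1.le⟩
      refine h₂ e heS t ht h1 ?_
      rw [← he]
      rcases h2.eq_or_lt with rfl | h3
      · exact h
      · exact (h₁ s hs e heS h3 h).le
    · rw [if_neg h2] at h
      exact h₂ s hs t ht hst h

lemma hasDerivAt_ite_le {f₁ f₂ k₁ k₂ : ℝ → ℝ} {e x : ℝ} (h₁ : HasDerivAt f₁ (k₁ x) x)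
    (h₂ : HasDerivAt f₂ (k₂ x) x) (hf : f₁ e = f₂ e) (hk : k₁ e = k₂ e) :
    HasDerivAt (fun y => if y ≤ e then f₁ y else f₂ y) (if x ≤ e then k₁ x else k₂ x) x := by
  rcases lt_trichotomy x e with h | rfl | h
  · rw [if_pos h.le]
    refine h₁.congr_of_eventuallyEq ?_
    filter_upwards [gt_mem_nhds h] with y hy using if_pos hy.le
  · rw [if_pos le_rfl, ← hasDerivWithinAt_univ, ← Set.Iic_union_Ici (a := x)]
    refine HasDerivWithinAt.union ?_ ?_
    · exact h₁.hasDerivWithinAt.congr (fun y hy => if_pos hy) (if_pos le_rfl)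
    · rw [hk]
      refine h₂.hasDerivWithinAt.congr (fun y hy => ?_) (by rw [if_pos le_rfl, hf])
      rcases (Set.mem_Ici.mp hy).eq_or_lt with rfl | h
      · rw [if_pos le_rfl, hf]
      · exact if_neg (not_le.mpr h)
  · rw [if_neg (not_le.mpr h)]
    refine h₂.congr_of_eventuallyEq ?_
    filter_upwards [lt_mem_nhds h] with y hy using if_neg (not_le.mpr hy)

/-- If the excess of `φ` over `k` has a negative derivative at its zeros, then `φ` crosses down. -/
lemma crossesDown_of_elasticity {q φ k : ℝ → ℝ} {α d : ℝ} (hα : 0 < α) (hq : ElasticityBound q)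
    (hφ : ∀ τ, 0 < τ → φ τ = q (α * τ) / τ)
    (hk : ∀ τ, 0 < τ → τ < d → 0 < k τ ∧ ∃ k', HasDerivAt k k' τ ∧
      ∀ r, τ * k τ ≤ 1 → 2 * r ≤ τ * k τ * (1 - (τ * k τ) ^ 2) →
        (τ * k τ < 1 → 2 * r < τ * k τ * (1 - (τ * k τ) ^ 2)) → r - τ * k τ < τ ^ 2 * k') :
    CrossesDown φ k (Set.Ioo 0 d) := by
  intro s hs t ht hst h
  have := neg_of_hasDerivAt_neg_of_eq_zero (f := fun τ => φ τ - k τ) hst (fun τ hτ => ?_)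
    (by linarith)
  · linarith
  have hτ0 : 0 < τ := hs.1.trans_le hτ.1
  obtain ⟨hkpos, k', hk', hineq⟩ := hk τ hτ0 (hτ.2.trans_lt ht.2)
  obtain ⟨q', hq', hb⟩ := hq (α * τ) (by positivity)
  have hcomp : HasDerivAt (fun t => q (α * t)) (q' * (α * 1)) τ :=
    hq'.comp τ ((hasDerivAt_id τ).const_mul α)
  have hφ' : HasDerivAt φ ((q' * (α * 1) * τ - q (α * τ) * 1) / τ ^ 2) τ := by
    refine (hcomp.div (hasDerivAt_id τ) hτ0.ne').congr_of_eventuallyEq ?_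
    filter_upwards [lt_mem_nhds hτ0] with y hy using hφ y hy
  refine ⟨_, hφ'.sub hk', fun h0 => ?_⟩
  have hqk : q (α * τ) = τ * k τ := by
    have : φ τ = k τ := by linarith
    rw [hφ τ hτ0, div_eq_iff hτ0.ne'] at this
    linarith
  rw [hqk] at hb ⊢
  obtain ⟨h1, h2, h3⟩ := hb (mul_pos hτ0 hkpos)
  have := hineq (α * τ * q') h1 h2 h3
  rw [sub_neg, div_lt_iff₀ (by positivity)]
  linarith

/-! ### The cost-efficient designs for a given inspection interval -/

namespace Costs

variable {C : Costs}

lemma hasDerivAt_K₁ (hmea : 0 < C.mea) (hop : 0 < C.op) {τ : ℝ} (hτ : 0 < τ) :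
    HasDerivAt C.K₁ (-C.K₁ τ ^ 2) τ := by
  have hpos : 0 < C.mea / C.op + τ := by positivity
  refine (((hasDerivAt_id τ).const_add (C.mea / C.op)).inv hpos.ne').congr_deriv ?_
  simp only [K₁, id]
  field_simp

lemma hasDerivAt_K₂ {τ : ℝ} (hτ : τ < 1 / C.op) :
    HasDerivAt C.K₂ (C.K₂ τ ^ 2) τ := by
  have hpos : 0 < 1 / C.op - τ := by linarith
  refine (((hasDerivAt_id τ).const_sub (1 / C.op)).inv hpos.ne').congr_deriv ?_
  simp only [K₂, id, inv_pow, neg_neg, one_div]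

/-- `K₃ = (τ² + bτ)^(-1/2)` satisfies a Bernoulli equation. -/
lemma hasDerivAt_K₃ (hit : 0 < C.it) (hmea : 0 < C.mea) (hop : 0 < C.op) {τ : ℝ} (hτ : 0 < τ) :
    HasDerivAt C.K₃ (-((τ * C.K₃ τ) ^ 3 + τ * C.K₃ τ) / (2 * τ ^ 2)) τ := by
  set B := C.mea / (C.op * C.it) with hB
  have hBpos : 0 < B := by positivity
  have hrad : ∀ t : ℝ, 0 < t → C.K₃ t = (Real.sqrt (t ^ 2 + B * t))⁻¹ := fun t ht => by
    have : t ^ 2 + B * t = t ^ 2 * (1 + C.mea / (C.op * C.it * t)) := by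
      rw [hB]; field_simp
    rw [this, Real.sqrt_mul (sq_nonneg t), Real.sqrt_sq ht.le, K₃]
  have hpos : 0 < τ ^ 2 + B * τ := by positivity
  have hs := Real.sqrt_pos.mpr hpos
  have hsq := Real.sq_sqrt hpos.le
  have hin : HasDerivAt (fun t : ℝ => t ^ 2 + B * t) (2 * τ + B) τ := by
    refine (((hasDerivAt_id τ).pow 2).add ((hasDerivAt_id τ).const_mul B)).congr_deriv ?_
    simp
  refine ((hin.sqrt hpos.ne').inv hs.ne').congr_of_eventuallyEq ?_ |>.congr_deriv ?_
  · filter_upwards [lt_mem_nhds hτ] with t ht using hrad t ht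
  · rw [hrad τ hτ]
    set R := Real.sqrt (τ ^ 2 + B * τ)
    have hBR : B = (R ^ 2 - τ ^ 2) / τ := by rw [hsq]; field_simp; ring
    rw [hBR]
    field_simp
    ring

/-- With `z = τ K₁ < 1` and `τ² K₁' = -z²`, the requirement is `r < z (1 - z)`, implied by `r < z (1
- z)(1 + z) / 2`. -/
lemma crossesDown_K₁ {q φ : ℝ → ℝ} {α d : ℝ} (hmea : 0 < C.mea) (hop : 0 < C.op) (hα : 0 < α)
    (hq : ElasticityBound q) (hφ : ∀ τ, 0 < τ → φ τ = q (α * τ) / τ) :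
    CrossesDown φ C.K₁ (Set.Ioo 0 d) := by
  refine crossesDown_of_elasticity hα hq hφ fun τ hτ _ => ?_
  have hpos : 0 < C.K₁ τ := by rw [K₁]; positivity
  have hlt : τ * C.K₁ τ < 1 := by
    rw [K₁, ← div_eq_mul_inv, div_lt_one (by positivity)]
    linarith [div_pos hmea hop]
  refine ⟨hpos, _, hasDerivAt_K₁ hmea hop hτ, fun r _ _ h => ?_⟩
  have h1 := h hlt
  have h0 : 0 < τ * C.K₁ τ := by positivity
  have e : τ ^ 2 * -C.K₁ τ ^ 2 = -(τ * C.K₁ τ) ^ 2 := by ring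
  rw [e]
  nlinarith [mul_pos h0 (sub_pos.mpr hlt), mul_pos (mul_pos h0 (sub_pos.mpr hlt)) (sub_pos.mpr hlt)]

/-- Here the rate increases and `z` may reach or exceed `1`, but `r < z + z²` already follows from
the non-strict bound. -/
lemma crossesDown_K₂ {q φ : ℝ → ℝ} {α : ℝ} (hα : 0 < α)
    (hq : ElasticityBound q) (hφ : ∀ τ, 0 < τ → φ τ = q (α * τ) / τ) :
    CrossesDown φ C.K₂ (Set.Ioo 0 (1 / C.op)) := by
  refine crossesDown_of_elasticity hα hq hφ fun τ hτ hτ' => ?_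
  have hpos : 0 < C.K₂ τ := by rw [K₂]; exact inv_pos.mpr (by linarith)
  refine ⟨hpos, _, hasDerivAt_K₂ hτ', fun r _ h _ => ?_⟩
  have h0 : 0 < τ * C.K₂ τ := by positivity
  have e : τ ^ 2 * C.K₂ τ ^ 2 = (τ * C.K₂ τ) ^ 2 := by ring
  rw [e]
  have h3 : 0 < (τ * C.K₂ τ) ^ 3 := by positivity
  nlinarith

/-- The tight case: the Bernoulli equation for `K₃` turns the requirement into exactly `2 r < z (1 -
z²)`, which explains the form of `ElasticityBound`. -/
lemma crossesDown_K₃ {q φ : ℝ → ℝ} {α d : ℝ} (hit : 0 < C.it) (hmea : 0 < C.mea) (hop : 0 < C.op)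
    (hα : 0 < α) (hq : ElasticityBound q) (hφ : ∀ τ, 0 < τ → φ τ = q (α * τ) / τ) :
    CrossesDown φ C.K₃ (Set.Ioo 0 d) := by
  refine crossesDown_of_elasticity hα hq hφ fun τ hτ _ => ?_
  have hpos : 0 < C.K₃ τ := by rw [K₃]; positivity
  have hlt : τ * C.K₃ τ < 1 := by
    have h1 : 1 < Real.sqrt (1 + C.mea / (C.op * C.it * τ)) := by
      rw [Real.lt_sqrt zero_le_one, one_pow]
      linarith [div_pos hmea (mul_pos (mul_pos hop hit) hτ)]
    rw [K₃, ← div_eq_mul_inv, div_lt_one (by positivity)]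
    nlinarith
  refine ⟨hpos, _, hasDerivAt_K₃ hit hmea hop hτ, fun r _ _ h => ?_⟩
  have h1 := h hlt
  have e : τ ^ 2 * (-((τ * C.K₃ τ) ^ 3 + τ * C.K₃ τ) / (2 * τ ^ 2))
      = -((τ * C.K₃ τ) ^ 3 + τ * C.K₃ τ) / 2 := by field_simp
  rw [e]
  linarith

/-- The square root in the formulas for `nOpt` and `mOpt`. -/
noncomputable def root (C : Costs) (τ : ℝ) : ℝ :=
  Real.sqrt (C.it ^ 2 + C.mea * C.it / (C.op * τ))

lemma root_sq (hit : 0 < C.it) (hmea : 0 < C.mea) (hop : 0 < C.op) {τ : ℝ} (hτ : 0 < τ) :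
    C.root τ ^ 2 = C.it ^ 2 + C.mea * C.it / (C.op * τ) :=
  Real.sq_sqrt (by positivity)

lemma it_lt_root (hit : 0 < C.it) (hmea : 0 < C.mea) (hop : 0 < C.op) {τ : ℝ} (hτ : 0 < τ) :
    C.it < C.root τ := by
  rw [root, Real.lt_sqrt hit.le]
  have : 0 < C.mea * C.it / (C.op * τ) := by positivity
  linarith

lemma nOpt_eq (hit : 0 < C.it) (hmea : 0 < C.mea) (hop : 0 < C.op) {τ : ℝ} (hτ : 0 < τ) :
    C.nOpt τ = 1 / (C.root τ + C.it) := by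
  have h1 := root_sq hit hmea hop hτ
  have h2 := it_lt_root hit hmea hop hτ
  have h3 : C.mea * C.it / (C.op * τ) = (C.root τ - C.it) * (C.root τ + C.it) := by
    linear_combination -h1
  have h4 : C.root τ - C.it ≠ 0 := by linarith
  have h5 : C.root τ + C.it ≠ 0 := by linarith
  change (-C.it + C.root τ) / (C.mea * C.it / (C.op * τ)) = _
  rw [h3]
  field_simp
  ring

lemma mOpt_eq (C : Costs) (τ : ℝ) : C.mOpt τ = (C.root τ - C.it) / C.mea := by
  rw [mOpt, root]
  ring

lemma K₃_eq (hit : 0 < C.it) (hop : 0 < C.op) {τ : ℝ} (hτ : 0 < τ) :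
    C.K₃ τ = C.it / (τ * C.root τ) := by
  have : C.it ^ 2 + C.mea * C.it / (C.op * τ)
      = C.it ^ 2 * (1 + C.mea / (C.op * C.it * τ)) := by field_simp
  rw [root, this, Real.sqrt_mul (sq_nonneg _), Real.sqrt_sq hit.le, K₃]
  field_simp

/-- The information multiplier `log (n m)` of a design. -/
noncomputable def _root_.GammaDesign.Design.logSize (ζ : Design) : ℝ := Real.log (ζ.n * ζ.m)

lemma hasDerivAt_logSize_designN1 (hmea : 0 < C.mea) (hop : 0 < C.op) (hit : C.it < 1)
    {τ : ℝ} (hτ : 0 < τ) :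
    HasDerivAt (fun t => (C.designN1 t).logSize) (-C.K₁ τ) τ := by
  have hpos : 0 < C.mea + C.op * τ := by positivity
  have h1 : 0 < 1 - C.it := by linarith
  have h := ((((hasDerivAt_id τ).const_mul C.op).const_add C.mea).log hpos.ne').const_sub
    (Real.log (1 - C.it))
  refine (h.congr_of_eventuallyEq ?_).congr_deriv ?_
  · filter_upwards [lt_mem_nhds hτ] with t ht
    have : 0 < C.mea + C.op * t := by positivity
    simp only [Design.logSize, designN1, one_mul, id]
    rw [Real.log_div h1.ne' this.ne']
  · rw [K₁]
    simp only [id]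
    field_simp

lemma hasDerivAt_logSize_designM1 (hit : 0 < C.it) (hmea : 0 < C.mea) (hop : 0 < C.op)
    {τ : ℝ} (hτ : τ < 1 / C.op) :
    HasDerivAt (fun t => (C.designM1 t).logSize) (-C.K₂ τ) τ := by
  have hpos : ∀ t, t < 1 / C.op → 0 < 1 - C.op * t := fun t ht => by
    rw [lt_div_iff₀ hop] at ht
    linarith
  have h := ((((hasDerivAt_id τ).const_mul C.op).const_sub 1).log (hpos τ hτ).ne').sub_const
    (Real.log (C.it + C.mea))
  refine (h.congr_of_eventuallyEq ?_).congr_deriv ?_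
  · filter_upwards [gt_mem_nhds hτ] with t ht
    simp only [Design.logSize, designM1, mul_one, id]
    rw [Real.log_div (hpos t ht).ne' (by positivity)]
  · have h1 := hpos τ hτ
    have e : 1 / C.op - τ = (1 - C.op * τ) / C.op := by field_simp
    rw [K₂, e, inv_div]
    simp only [id]
    ring

lemma hasDerivAt_logSize_designNM (hit : 0 < C.it) (hmea : 0 < C.mea) (hop : 0 < C.op)
    {τ : ℝ} (hτ : 0 < τ) :
    HasDerivAt (fun t => (C.designNM t).logSize) (-C.K₃ τ) τ := by
  -- Trading `root + it` for its conjugate makes `n m` a constant times `(root - it)² t`, whose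
  -- logarithm is easy to differentiate.
  have hsize : ∀ t, 0 < t → (C.designNM t).logSize
      = 2 * Real.log (C.root t - C.it) + Real.log t
        - Real.log (C.it * C.mea ^ 2 / C.op) := fun t ht => by
    have h1 := root_sq hit hmea hop ht
    have h2 : 0 < C.root t - C.it := sub_pos.mpr (it_lt_root hit hmea hop ht)
    have h3 : 0 < C.root t + C.it := by linarith
    have h4 : C.root t + C.it = C.mea * C.it / (C.op * t) / (C.root t - C.it) := by
      rw [eq_div_iff h2.ne']
      linear_combination h1
    have e : C.nOpt t * C.mOpt t
        = (C.root t - C.it) ^ 2 * t / (C.it * C.mea ^ 2 / C.op) := by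
      rw [nOpt_eq hit hmea hop ht, mOpt_eq, h4]
      field_simp
    simp only [Design.logSize, designNM]
    rw [e, Real.log_div (by positivity) (by positivity), Real.log_mul (by positivity) ht.ne',
      Real.log_pow]
    push_cast
    ring
  have hrad : 0 < C.it ^ 2 + C.mea * C.it / (C.op * τ) := by positivity
  have hin : HasDerivAt (fun t : ℝ => C.it ^ 2 + C.mea * C.it / (C.op * t))
      ((0 * (C.op * τ) - C.mea * C.it * (C.op * 1)) / (C.op * τ) ^ 2) τ :=
    ((hasDerivAt_const τ (C.mea * C.it)).div ((hasDerivAt_id τ).const_mul C.op)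
      (by simp only [id]; positivity)).const_add _
  have hroot := hin.sqrt hrad.ne'
  have h2 : 0 < C.root τ - C.it := sub_pos.mpr (it_lt_root hit hmea hop hτ)
  have h := ((((hroot.sub_const C.it).log h2.ne').const_mul 2).add
    (Real.hasDerivAt_log hτ.ne')).sub_const (Real.log (C.it * C.mea ^ 2 / C.op))
  refine (h.congr_of_eventuallyEq ?_).congr_deriv ?_
  · filter_upwards [lt_mem_nhds hτ] with t ht using hsize t ht
  · have h1 := root_sq hit hmea hop hτ
    rw [K₃_eq hit hop hτ]
    change 2 * ((0 * (C.op * τ) - C.mea * C.it * (C.op * 1)) / (C.op * τ) ^ 2 / (2 * C.root τ)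
      / (C.root τ - C.it)) + τ⁻¹ = _
    have h5 : 0 < C.root τ := by linarith
    have h6 : C.mea = (C.root τ ^ 2 - C.it ^ 2) * (C.op * τ) / C.it := by
      rw [h1]; field_simp; ring
    rw [h6]
    field_simp
    ring

/-- At this interval the root equals `1 - C.it`, which is the condition `n(τ) = 1`. Agreement of
rates is what later makes the glued size differentiable. -/
lemma designNM_tauL (hit : 0 < C.it) (hmea : 0 < C.mea) (hop : 0 < C.op)
    (hκ : 0 < 1 - 2 * C.it - C.mea) :
    C.designNM C.tauL = C.designN1 C.tauL ∧ C.K₃ C.tauL = C.K₁ C.tauL ∧ 0 < C.tauL := by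
  have h1 : 0 < 1 - 2 * C.it := by linarith
  have h2 : 0 < 1 - C.it := by linarith
  have hτ : 0 < C.tauL := by rw [tauL]; positivity
  have hroot : C.root C.tauL = 1 - C.it := by
    rw [root, Real.sqrt_eq_iff_mul_self_eq (by positivity) h2.le, tauL]
    field_simp
    ring
  refine ⟨?_, ?_, hτ⟩
  · ext
    · simp only [designNM, designN1]
      rw [nOpt_eq hit hmea hop hτ, hroot]
      simp
    · simp only [designNM, designN1]
      rw [mOpt_eq, hroot, tauL]
      have : C.mea + C.op * (C.it * C.mea / (C.op * (1 - 2 * C.it)))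
          = C.mea * (1 - C.it) / (1 - 2 * C.it) := by
        have e : C.op * (C.it * C.mea / (C.op * (1 - 2 * C.it)))
            = C.it * C.mea / (1 - 2 * C.it) := by
          rw [← mul_div_assoc, mul_div_mul_left _ _ hop.ne']
        rw [e, eq_div_iff h1.ne', add_mul, div_mul_cancel₀ _ h1.ne']
        ring
      rw [this]
      field_simp
      ring
    · rfl
  · rw [K₃_eq hit hop hτ, hroot, K₁, tauL]
    have : C.mea / C.op + C.it * C.mea / (C.op * (1 - 2 * C.it))
          = C.mea * (1 - C.it) / (C.op * (1 - 2 * C.it)) := by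
      have hne : C.op * (1 - 2 * C.it) ≠ 0 := by positivity
      rw [eq_div_iff hne, add_mul, div_mul_cancel₀ _ hne, ← mul_assoc, div_mul_cancel₀ _ hop.ne']
      ring
    rw [this]
    field_simp

lemma designNM_tauU (hit : 0 < C.it) (hmea : 0 < C.mea) (hop : 0 < C.op) :
    C.designNM C.tauU = C.designM1 C.tauU ∧ C.K₃ C.tauU = C.K₂ C.tauU ∧ 0 < C.tauU := by
  have hτ : 0 < C.tauU := by rw [tauU]; positivity
  have hroot : C.root C.tauU = C.it + C.mea := by
    rw [root, Real.sqrt_eq_iff_mul_self_eq (by positivity) (by positivity), tauU]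
    field_simp
    ring
  refine ⟨?_, ?_, hτ⟩
  · ext
    · simp only [designNM, designM1]
      rw [nOpt_eq hit hmea hop hτ, hroot, tauU]
      have : 1 - C.op * (C.it / (C.op * (C.mea + 2 * C.it)))
          = (C.it + C.mea) / (C.mea + 2 * C.it) := by field_simp; ring
      rw [this]
      field_simp
      ring
    · simp only [designNM, designM1]
      rw [mOpt_eq, hroot]
      field_simp
      ring
    · rfl
  · rw [K₃_eq hit hop hτ, hroot, K₂, tauU]
    have : 1 / C.op - C.it / (C.op * (C.mea + 2 * C.it))
          = (C.it + C.mea) / (C.op * (C.mea + 2 * C.it)) := by field_simp; ring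
    rw [this]
    field_simp

lemma tauL_lt_tauU (hit : 0 < C.it) (hmea : 0 < C.mea) (hop : 0 < C.op)
    (hκ : 0 < 1 - 2 * C.it - C.mea) : C.tauL < C.tauU := by
  have h1 : 0 < 1 - 2 * C.it := by linarith
  rw [tauL, tauU, div_lt_div_iff₀ (by positivity) (by positivity)]
  have : 0 < C.it * C.op * ((1 + C.mea) * (1 - 2 * C.it - C.mea)) := by positivity
  nlinarith

lemma tauU_lt_tauMax (hit : 0 < C.it) (hmea : 0 < C.mea) (hop : 0 < C.op)
    (hκ : 0 < 1 - 2 * C.it - C.mea) : C.tauU < C.tauMax := by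
  rw [tauU, tauMax, div_lt_div_iff₀ (by positivity) hop]
  have : 0 < C.op * ((C.it + C.mea) * (1 - 2 * C.it - C.mea)) := by positivity
  nlinarith

/-! ### Feasibility and maximal size for a fixed interval -/

lemma feasible_designN1 (hmea : 0 < C.mea) (hop : 0 < C.op) {δ τ : ℝ}
    (hδ : 0 < δ) (hδτ : δ ≤ τ) (hτ : τ ≤ C.tauMax) : Feasible C δ (C.designN1 τ) := by
  have hτ0 : 0 < τ := hδ.trans_le hδτ
  have hpos : 0 < C.mea + C.op * τ := by positivity
  rw [tauMax, le_div_iff₀ hop] at hτ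
  refine ⟨?_, hδτ, le_rfl, ?_⟩
  · simp only [total, designN1]
    field_simp
    ring
  · simp only [designN1]
    rw [one_le_div hpos]
    linarith

lemma feasible_designM1 (hit : 0 < C.it) (hmea : 0 < C.mea) (hop : 0 < C.op) {δ τ : ℝ}
    (hδτ : δ ≤ τ) (hτ : τ ≤ C.tauMax) : Feasible C δ (C.designM1 τ) := by
  rw [tauMax, le_div_iff₀ hop] at hτ
  refine ⟨?_, hδτ, ?_, le_rfl⟩
  · simp only [total, designM1]
    field_simp
    ring
  · simp only [designM1]
    rw [one_le_div (by positivity)]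
    linarith

lemma total_designNM (hit : 0 < C.it) (hmea : 0 < C.mea) (hop : 0 < C.op) {τ : ℝ} (hτ : 0 < τ) :
    C.total (C.designNM τ) = 1 ∧ C.it * C.nOpt τ = C.op * τ * C.mOpt τ := by
  have h1 := root_sq hit hmea hop hτ
  have h2 : 0 < C.root τ - C.it := sub_pos.mpr (it_lt_root hit hmea hop hτ)
  have h3 : 0 < C.root τ + C.it := by linarith
  have hbal : C.it * C.nOpt τ = C.op * τ * C.mOpt τ := by
    rw [nOpt_eq hit hmea hop hτ, mOpt_eq, mul_one_div, div_eq_iff h3.ne']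
    have : C.op * τ * ((C.root τ - C.it) / C.mea) * (C.root τ + C.it)
        = C.op * τ * (C.root τ ^ 2 - C.it ^ 2) / C.mea := by ring
    rw [this, h1]
    field_simp
    ring
  refine ⟨?_, hbal⟩
  have : C.total (C.designNM τ) = 2 * (C.it * C.nOpt τ) + C.mea * (C.nOpt τ * C.mOpt τ) := by
    simp only [total, designNM]
    linear_combination -hbal
  rw [this, nOpt_eq hit hmea hop hτ, mOpt_eq]
  field_simp
  ring

lemma feasible_designNM (hit : 0 < C.it) (hmea : 0 < C.mea) (hop : 0 < C.op)
    (hκ : 0 < 1 - 2 * C.it - C.mea) {δ τ : ℝ}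
    (hδ : 0 < δ) (hδτ : δ ≤ τ) (hl : C.tauL ≤ τ) (hu : τ ≤ C.tauU) :
    Feasible C δ (C.designNM τ) := by
  have hτ : 0 < τ := hδ.trans_le hδτ
  have h1 := root_sq hit hmea hop hτ
  have h2 := it_lt_root hit hmea hop hτ
  have h4 : 0 < 1 - 2 * C.it := by linarith
  rw [tauL, div_le_iff₀ (by positivity)] at hl
  rw [tauU, le_div_iff₀ (by positivity)] at hu
  refine ⟨(total_designNM hit hmea hop hτ).1, hδτ, ?_, ?_⟩
  · simp only [designNM]
    rw [nOpt_eq hit hmea hop hτ, one_le_div (by linarith)]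
    have h5 : C.mea * C.it / (C.op * τ) ≤ 1 - 2 * C.it := by
      rw [div_le_iff₀ (by positivity)]
      linarith
    have : C.root τ ^ 2 ≤ (1 - C.it) ^ 2 := by rw [h1]; linarith
    have := abs_le_of_sq_le_sq this (by linarith)
    linarith [le_abs_self (C.root τ)]
  · simp only [designNM]
    rw [mOpt_eq, one_le_div hmea]
    have h5 : C.mea * (C.mea + 2 * C.it) ≤ C.mea * C.it / (C.op * τ) := by
      rw [le_div_iff₀ (by positivity)]
      have := mul_le_mul_of_nonneg_left hu hmea.le
      linarith
    have : (C.it + C.mea) ^ 2 ≤ C.root τ ^ 2 := by rw [h1]; linarith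
    have := (sq_le_sq₀ (by positivity) (by linarith)).mp this
    linarith

lemma tau_mem_of_feasible (hit : 0 < C.it) (hmea : 0 < C.mea) (hop : 0 < C.op) {δ : ℝ}
    (hδ : 0 < δ) {ζ : Design} (h : Feasible C δ ζ) : ζ.τ ∈ Set.Icc δ C.tauMax := by
  obtain ⟨ht, hτ, hn, hm⟩ := h
  have hτ0 : 0 < ζ.τ := hδ.trans_le hτ
  refine ⟨hτ, ?_⟩
  rw [tauMax, le_div_iff₀ hop]
  have h1 : C.it * 1 ≤ C.it * ζ.n := by gcongr
  have h2 : C.mea * (1 * 1) ≤ C.mea * (ζ.n * ζ.m) := by gcongr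
  have h3 : C.op * (1 * ζ.τ) ≤ C.op * (ζ.m * ζ.τ) := by gcongr
  rw [total] at ht
  linarith

/-- Eliminating `m` through the budget, the comparison has a factor `n - 1`; the regime condition
makes the other factor positive. It is stated without division since `1 - 2 * C.it` may be
nonpositive. -/
lemma size_lt_designN1 (hit : 0 < C.it) (hmea : 0 < C.mea) (hop : 0 < C.op) {δ : ℝ} (hδ : 0 < δ)
    {ζ : Design} (h : Feasible C δ ζ) (hreg : (1 - 2 * C.it) * (C.op * ζ.τ) ≤ C.it * C.mea)
    (hne : ζ ≠ C.designN1 ζ.τ) :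
    ζ.n * ζ.m < (C.designN1 ζ.τ).n * (C.designN1 ζ.τ).m := by
  obtain ⟨n, m, τ⟩ := ζ
  obtain ⟨ht, hτ, hn, hm⟩ := h
  simp only [total] at ht hτ hn hm hreg hne ⊢
  have hτ0 : 0 < τ := hδ.trans_le hτ
  have hden : 0 < C.mea + C.op * τ := by positivity
  have hden' : 0 < C.mea * n + C.op * τ := by positivity
  have hm' : m = (1 - C.it * n) / (C.mea * n + C.op * τ) := by
    rw [eq_div_iff hden'.ne']; linarith
  have hn1 : 1 < n := by
    refine lt_of_le_of_ne hn fun h1 => hne ?_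
    subst h1
    simp only [designN1, hm', mul_one]
  simp only [designN1, one_mul]
  rw [hm', ← mul_div_assoc, div_lt_div_iff₀ hden' hden]
  have key : 0 < (n - 1) * (C.it * (C.mea + C.op * τ) * n - (1 - C.it) * (C.op * τ)) := by
    refine mul_pos (by linarith) ?_
    have : C.it * (C.mea + C.op * τ) * 1 < C.it * (C.mea + C.op * τ) * n := by gcongr
    linarith
  linarith

lemma size_lt_designM1 (hit : 0 < C.it) (hmea : 0 < C.mea) (hop : 0 < C.op) {δ : ℝ} (hδ : 0 < δ)
    {ζ : Design} (h : Feasible C δ ζ) (hreg : C.tauU ≤ ζ.τ) (hne : ζ ≠ C.designM1 ζ.τ) :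
    ζ.n * ζ.m < (C.designM1 ζ.τ).n * (C.designM1 ζ.τ).m := by
  obtain ⟨n, m, τ⟩ := ζ
  obtain ⟨ht, hτ, hn, hm⟩ := h
  simp only [total] at ht hτ hn hm hreg hne ⊢
  have hτ0 : 0 < τ := hδ.trans_le hτ
  rw [tauU, div_le_iff₀ (by positivity)] at hreg
  have hden : 0 < C.it + C.mea := by positivity
  have hden' : 0 < C.it + C.mea * m := by positivity
  have hn' : n = (1 - C.op * τ * m) / (C.it + C.mea * m) := by
    rw [eq_div_iff hden'.ne']; linarith
  have hm1 : 1 < m := by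
    refine lt_of_le_of_ne hm fun h1 => hne ?_
    subst h1
    simp only [designM1, hn', mul_one]
  simp only [designM1, mul_one]
  rw [hn', div_mul_eq_mul_div, div_lt_div_iff₀ hden' hden]
  have key : 0 < (m - 1) * (C.op * τ * (C.it + C.mea) * m - (1 - C.op * τ) * C.it) := by
    refine mul_pos (by linarith) ?_
    have : C.op * τ * (C.it + C.mea) * 1 < C.op * τ * (C.it + C.mea) * m := by gcongr
    linarith
  linarith

/-- AM-GM with its equality case: a product at least `n₀ m₀` leaves at most `2 C_it n₀` for `C_it n
+ C_op τ m`, which forces the two costs to be equal and then `n = n₀`, `m = m₀`. -/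
lemma size_lt_designNM (hit : 0 < C.it) (hmea : 0 < C.mea) (hop : 0 < C.op) {δ : ℝ} (hδ : 0 < δ)
    {ζ : Design} (h : Feasible C δ ζ) (hne : ζ ≠ C.designNM ζ.τ) :
    ζ.n * ζ.m < (C.designNM ζ.τ).n * (C.designNM ζ.τ).m := by
  obtain ⟨n, m, τ⟩ := ζ
  obtain ⟨ht, hτ, hn, hm⟩ := h
  simp only at hτ hn hm hne ⊢
  have hτ0 : 0 < τ := hδ.trans_le hτ
  obtain ⟨h1, h2⟩ := total_designNM hit hmea hop hτ0
  simp only [total, designNM] at ht h1 ⊢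
  set n₀ := C.nOpt τ with hn₀
  set m₀ := C.mOpt τ with hm₀
  by_contra! hge
  have hsum : C.it * n + C.op * τ * m ≤ 2 * (C.it * n₀) := by
    have := mul_le_mul_of_nonneg_left hge hmea.le
    linarith
  have hsum0 : 0 ≤ C.it * n + C.op * τ * m := by positivity
  have hsq : (C.it * n + C.op * τ * m) ^ 2 ≤ 4 * C.it * (C.op * τ) * (n₀ * m₀) := by
    calc _ ≤ (2 * (C.it * n₀)) ^ 2 := by gcongr
      _ = 4 * C.it * (C.op * τ) * (n₀ * m₀) := by linear_combination 4 * C.it * n₀ * h2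
  have hge' : 4 * C.it * (C.op * τ) * (n₀ * m₀) ≤ 4 * C.it * (C.op * τ) * (n * m) := by gcongr
  have hz : (C.it * n - C.op * τ * m) ^ 2 ≤ 0 := by nlinarith
  have hbal : C.it * n = C.op * τ * m := by
    have := pow_eq_zero_iff two_ne_zero |>.mp (le_antisymm hz (sq_nonneg _))
    linarith
  have hnle : n ≤ n₀ := by
    have : C.it * n ≤ C.it * n₀ := by linarith
    exact le_of_mul_le_mul_left this hit
  have hmle : m ≤ m₀ := by
    have : C.op * τ * m ≤ C.op * τ * m₀ := by linarith
    exact le_of_mul_le_mul_left this (by positivity)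
  have hn_eq : n = n₀ := by nlinarith
  have hm_eq : m = m₀ := by nlinarith
  exact hne (by simp only [designNM]; rw [hn_eq, hm_eq])

end Costs

/-! ### Optimization of the inspection interval -/

/-- `best τ` is the unique largest feasible design with interval `τ`, `k` is minus the logarithmic
derivative of its size, and `φ` crosses `k` downwards. -/
structure IsBestResponse (C : Costs) (δ : ℝ) (φ : ℝ → ℝ) (best : ℝ → Design) (k : ℝ → ℝ) :
    Prop where
  feasible : ∀ τ ∈ Set.Icc δ C.tauMax, Feasible C δ (best τ)
  tau_eq : ∀ τ, (best τ).τ = τ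
  size_lt : ∀ ζ, Feasible C δ ζ → ζ ≠ best ζ.τ →
    ζ.n * ζ.m < (best ζ.τ).n * (best ζ.τ).m
  hasDerivAt : ∀ τ ∈ Set.Icc δ C.tauMax, HasDerivAt (fun t => (best t).logSize) (-k τ) τ
  crossesDown : CrossesDown φ k (Set.Icc δ C.tauMax)

/-- The objective is a decreasing function of the logarithm of the efficiency. -/
def HasLogEfficiency (f : Design → ℝ) (L : ℝ → ℝ) : Prop :=
  ∃ c : ℝ, 0 < c ∧ ∀ ζ : Design, 0 < ζ.n → 0 < ζ.m → 0 < ζ.τ →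
    f ζ = Real.exp (-(c * (ζ.logSize + L ζ.τ)))

namespace IsBestResponse

variable {C : Costs} {δ : ℝ} {φ k : ℝ → ℝ} {best : ℝ → Design} {f : Design → ℝ} {L : ℝ → ℝ}

/-- The value along best responses rises strictly up to `τ` and falls strictly after it. Uniqueness
comes from this for other intervals and from `size_lt` at the same interval. -/
lemma isOptimalDesign_of_sign (h : IsBestResponse C δ φ best k)
    (hC : 0 < C.it ∧ 0 < C.mea ∧ 0 < C.op) (hδ : 0 < δ) (hf : HasLogEfficiency f L)
    (hL : ∀ τ, 0 < τ → HasDerivAt L (φ τ) τ) {τ : ℝ} (hτ : τ ∈ Set.Icc δ C.tauMax)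
    (hlt : ∀ t ∈ Set.Icc δ C.tauMax, t < τ → k t < φ t)
    (hgt : ∀ t ∈ Set.Icc δ C.tauMax, τ < t → φ t < k t) :
    IsOptimalDesign C δ f (best τ) := by
  obtain ⟨c, hc, hf⟩ := hf
  have hV : ∀ t ∈ Set.Icc δ C.tauMax,
      HasDerivAt (fun t => (best t).logSize + L t) (-k t + φ t) t := fun t ht =>
    (h.hasDerivAt t ht).add (hL t (hδ.trans_le ht.1))
  have hmono : StrictMonoOn (fun t => (best t).logSize + L t) (Set.Icc δ τ) := by
    refine strictMonoOn_of_deriv_pos (convex_Icc _ _) (fun t ht => ?_) fun t ht => ?_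
    · exact (hV t ⟨ht.1, ht.2.trans hτ.2⟩).continuousAt.continuousWithinAt
    · rw [interior_Icc] at ht
      have ht' : t ∈ Set.Icc δ C.tauMax := ⟨ht.1.le, ht.2.le.trans hτ.2⟩
      rw [(hV t ht').deriv]
      linarith [hlt t ht' ht.2]
  have hanti : StrictAntiOn (fun t => (best t).logSize + L t) (Set.Icc τ C.tauMax) := by
    refine strictAntiOn_of_deriv_neg (convex_Icc _ _) (fun t ht => ?_) fun t ht => ?_
    · exact (hV t ⟨hτ.1.trans ht.1, ht.2⟩).continuousAt.continuousWithinAt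
    · rw [interior_Icc] at ht
      have ht' : t ∈ Set.Icc δ C.tauMax := ⟨hτ.1.trans ht.1.le, ht.2.le⟩
      rw [(hV t ht').deriv]
      linarith [hgt t ht' ht.1]
  have hpos : ∀ ζ, Feasible C δ ζ → 0 < ζ.n ∧ 0 < ζ.m ∧ 0 < ζ.τ := fun ζ hζ =>
    ⟨one_pos.trans_le hζ.2.2.1, one_pos.trans_le hζ.2.2.2, hδ.trans_le hζ.2.1⟩
  have hbest := h.feasible τ hτ
  refine ⟨hbest, fun ζ hζ hne => ?_⟩
  have hζτ := Costs.tau_mem_of_feasible hC.1 hC.2.1 hC.2.2 hδ hζ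
  obtain ⟨b1, b2, b3⟩ := hpos _ hbest
  obtain ⟨z1, z2, z3⟩ := hpos _ hζ
  rw [hf _ b1 b2 b3, hf _ z1 z2 z3, Real.exp_lt_exp, neg_lt_neg_iff]
  refine mul_lt_mul_of_pos_left ?_ hc
  rw [h.tau_eq]
  have hsize : ζ ≠ best ζ.τ → ζ.logSize < (best ζ.τ).logSize := fun hne' =>
    Real.log_lt_log (by positivity) (h.size_lt ζ hζ hne')
  have hsize_le : ζ.logSize ≤ (best ζ.τ).logSize := by
    by_cases he : ζ = best ζ.τ
    · rw [← he]
    · exact (hsize he).le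
  rcases lt_trichotomy ζ.τ τ with hlt' | heq | hgt'
  · have := hmono ⟨hζτ.1, hlt'.le⟩ ⟨hτ.1, le_rfl⟩ hlt'
    simp only at this
    linarith
  · rw [← heq] at hne ⊢
    linarith [hsize hne]
  · have := hanti ⟨le_rfl, hτ.2⟩ ⟨hgt'.le, hζτ.2⟩ hgt'
    simp only at this
    linarith

lemma isOptimalDesign_of_eq (h : IsBestResponse C δ φ best k)
    (hC : 0 < C.it ∧ 0 < C.mea ∧ 0 < C.op) (hδ : 0 < δ) (hf : HasLogEfficiency f L)
    (hL : ∀ τ, 0 < τ → HasDerivAt L (φ τ) τ) {τ : ℝ} (hτ : τ ∈ Set.Icc δ C.tauMax)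
    (he : φ τ = k τ) :
    IsOptimalDesign C δ f (best τ) := by
  refine h.isOptimalDesign_of_sign hC hδ hf hL hτ (fun t ht htτ => ?_)
    fun t ht htτ => h.crossesDown τ hτ t ht htτ he.le
  by_contra! hle
  exact absurd he (h.crossesDown t ht τ hτ htτ hle).ne

lemma isOptimalDesign_left (h : IsBestResponse C δ φ best k)
    (hC : 0 < C.it ∧ 0 < C.mea ∧ 0 < C.op) (hδ : 0 < δ) (hf : HasLogEfficiency f L)
    (hL : ∀ τ, 0 < τ → HasDerivAt L (φ τ) τ)
    (hδτ : δ ≤ C.tauMax) (he : φ δ ≤ k δ) :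
    IsOptimalDesign C δ f (best δ) :=
  h.isOptimalDesign_of_sign hC hδ hf hL ⟨le_rfl, hδτ⟩ (fun _ ht htδ => absurd ht.1 htδ.not_ge)
    fun t ht hδt => h.crossesDown δ ⟨le_rfl, hδτ⟩ t ht hδt he

lemma isOptimalDesign_right (h : IsBestResponse C δ φ best k)
    (hC : 0 < C.it ∧ 0 < C.mea ∧ 0 < C.op) (hδ : 0 < δ) (hf : HasLogEfficiency f L)
    (hL : ∀ τ, 0 < τ → HasDerivAt L (φ τ) τ)
    (hδτ : δ ≤ C.tauMax) (he : k C.tauMax ≤ φ C.tauMax) :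
    IsOptimalDesign C δ f (best C.tauMax) := by
  refine h.isOptimalDesign_of_sign hC hδ hf hL ⟨hδτ, le_rfl⟩ (fun t ht htτ => ?_)
    fun _ ht htτ => absurd ht.2 htτ.not_ge
  by_contra! hle
  exact absurd he (h.crossesDown t ht _ ⟨hδτ, le_rfl⟩ htτ hle).not_ge

lemma exists_isOptimalDesign (h : IsBestResponse C δ φ best k)
    (hC : 0 < C.it ∧ 0 < C.mea ∧ 0 < C.op) (hδ : 0 < δ) (hf : HasLogEfficiency f L)
    (hL : ∀ τ, 0 < τ → HasDerivAt L (φ τ) τ)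
    (hδτ : δ ≤ C.tauMax) :
    ∃ τ ∈ Set.Icc δ C.tauMax, IsOptimalDesign C δ f (best τ) ∧
      ((τ = δ ∧ φ δ ≤ k δ) ∨ (τ = C.tauMax ∧ k C.tauMax ≤ φ C.tauMax) ∨
        (δ < τ ∧ τ < C.tauMax ∧ φ τ = k τ)) := by
  by_cases h1 : φ δ ≤ k δ
  · exact ⟨δ, ⟨le_rfl, hδτ⟩, h.isOptimalDesign_left hC hδ hf hL hδτ h1, Or.inl ⟨rfl, h1⟩⟩
  by_cases h2 : k C.tauMax ≤ φ C.tauMax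
  · exact ⟨C.tauMax, ⟨hδτ, le_rfl⟩, h.isOptimalDesign_right hC hδ hf hL hδτ h2,
      Or.inr (Or.inl ⟨rfl, h2⟩)⟩
  push Not at h1 h2
  -- Darboux's theorem: `φ - k` is a derivative, so it has a zero between opposite signs, with no
  -- continuity of `φ` required.
  obtain ⟨τ, hτ, he⟩ := exists_hasDerivWithinAt_eq_of_lt_of_gt hδτ
    (f := fun t => (best t).logSize + L t) (f' := fun t => -k t + φ t) (m := 0)
    (fun t ht => ((h.hasDerivAt t ht).add (hL t (hδ.trans_le ht.1))).hasDerivWithinAt)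
    (by linarith) (by linarith)
  have he' : φ τ = k τ := by simp only at he; linarith
  have hτ' := Set.Ioo_subset_Icc_self hτ
  exact ⟨τ, hτ', h.isOptimalDesign_of_eq hC hδ hf hL hτ' he', Or.inr (Or.inr ⟨hτ.1, hτ.2, he'⟩)⟩

end IsBestResponse

/-! ### Best responses in the two cost regimes -/

namespace Costs

variable {C : Costs} {δ : ℝ} {φ q : ℝ → ℝ} {α : ℝ}

lemma tauMax_lt (hit : 0 < C.it) (hmea : 0 < C.mea) (hop : 0 < C.op) : C.tauMax < 1 / C.op := by
  rw [tauMax]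
  gcongr
  linarith

lemma Icc_subset_Ioo (hit : 0 < C.it) (hmea : 0 < C.mea) (hop : 0 < C.op) (hδ : 0 < δ) :
    Set.Icc δ C.tauMax ⊆ Set.Ioo 0 (1 / C.op) :=
  fun _ hτ => ⟨hδ.trans_le hτ.1, hτ.2.trans_lt (tauMax_lt hit hmea hop)⟩

/-- When units are expensive, a single unit is always best. -/
lemma isBestResponse_designN1 (hit : 0 < C.it) (hmea : 0 < C.mea) (hop : 0 < C.op) (hδ : 0 < δ)
    (hκ : 1 - 2 * C.it - C.mea ≤ 0) (hit₁ : C.it < 1) (hα : 0 < α)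
    (hq : ElasticityBound q) (hφ : ∀ τ, 0 < τ → φ τ = q (α * τ) / τ) :
    IsBestResponse C δ φ C.designN1 C.K₁ where
  feasible τ hτ := feasible_designN1 hmea hop hδ hτ.1 hτ.2
  tau_eq _ := rfl
  size_lt ζ hζ hne := by
    refine size_lt_designN1 hit hmea hop hδ hζ ?_ hne
    have hτ := tau_mem_of_feasible hit hmea hop hδ hζ
    have hτ2 := hτ.2
    rw [tauMax, le_div_iff₀ hop] at hτ2
    have hτ0 : 0 < C.op * ζ.τ := mul_pos hop (hδ.trans_le hτ.1)
    rcases le_or_gt (1 - 2 * C.it) 0 with h | h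
    · have : 0 < C.it * C.mea := by positivity
      nlinarith
    -- It suffices to check `τ_max`, where the claim reads `(1 - C_it) κ ≤ 0`.
    · have h1 : (1 - 2 * C.it) * (C.op * ζ.τ) ≤ (1 - 2 * C.it) * (1 - C.it - C.mea) :=
        mul_le_mul_of_nonneg_left (by linarith) h.le
      nlinarith [mul_nonneg (by linarith : 0 ≤ 1 - C.it)
        (by linarith : 0 ≤ -(1 - 2 * C.it - C.mea))]
  hasDerivAt τ hτ := hasDerivAt_logSize_designN1 hmea hop hit₁ (hδ.trans_le hτ.1)
  crossesDown := (crossesDown_K₁ hmea hop hα hq hφ).mono (Icc_subset_Ioo hit hmea hop hδ)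

/-- The best design for each inspection interval when units are cheap. -/
noncomputable def bestDesign (C : Costs) (τ : ℝ) : Design :=
  if τ ≤ C.tauL then C.designN1 τ else if τ ≤ C.tauU then C.designNM τ else C.designM1 τ

/-- Minus the logarithmic derivative of the size of `bestDesign`. -/
noncomputable def bestRate (C : Costs) (τ : ℝ) : ℝ :=
  if τ ≤ C.tauL then C.K₁ τ else if τ ≤ C.tauU then C.K₃ τ else C.K₂ τ

lemma best_of_le_tauL {τ : ℝ} (h : τ ≤ C.tauL) :
    C.bestDesign τ = C.designN1 τ ∧ C.bestRate τ = C.K₁ τ := by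
  simp only [bestDesign, bestRate, if_pos h, and_self]

lemma best_of_mem_Icc (hit : 0 < C.it) (hmea : 0 < C.mea) (hop : 0 < C.op)
    (hκ : 0 < 1 - 2 * C.it - C.mea) {τ : ℝ} (hl : C.tauL ≤ τ) (hu : τ ≤ C.tauU) :
    C.bestDesign τ = C.designNM τ ∧ C.bestRate τ = C.K₃ τ := by
  rcases hl.eq_or_lt with rfl | hl
  · have h := designNM_tauL hit hmea hop hκ
    rw [h.1, h.2.1]
    exact best_of_le_tauL le_rfl
  · simp only [bestDesign, bestRate, if_neg hl.not_ge, if_pos hu, and_self]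

lemma best_of_tauU_le (hit : 0 < C.it) (hmea : 0 < C.mea) (hop : 0 < C.op)
    (hκ : 0 < 1 - 2 * C.it - C.mea) {τ : ℝ} (hu : C.tauU ≤ τ) :
    C.bestDesign τ = C.designM1 τ ∧ C.bestRate τ = C.K₂ τ := by
  have hlu := tauL_lt_tauU hit hmea hop hκ
  rcases hu.eq_or_lt with rfl | hu
  · have h := designNM_tauU hit hmea hop
    rw [← h.1, ← h.2.1]
    exact best_of_mem_Icc hit hmea hop hκ hlu.le le_rfl
  · simp only [bestDesign, bestRate, if_neg (hlu.trans hu).not_ge, if_neg hu.not_ge, and_self]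

lemma isBestResponse_bestDesign (hit : 0 < C.it) (hmea : 0 < C.mea) (hop : 0 < C.op) (hδ : 0 < δ)
    (hκ : 0 < 1 - 2 * C.it - C.mea) (hα : 0 < α)
    (hq : ElasticityBound q) (hφ : ∀ τ, 0 < τ → φ τ = q (α * τ) / τ) :
    IsBestResponse C δ φ C.bestDesign C.bestRate where
  feasible τ hτ := by
    rcases le_or_gt τ C.tauL with h1 | h1
    · rw [(best_of_le_tauL h1).1]
      exact feasible_designN1 hmea hop hδ hτ.1 hτ.2
    rcases le_or_gt τ C.tauU with h2 | h2
    · rw [(best_of_mem_Icc hit hmea hop hκ h1.le h2).1]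
      exact feasible_designNM hit hmea hop hκ hδ hτ.1 h1.le h2
    · rw [(best_of_tauU_le hit hmea hop hκ h2.le).1]
      exact feasible_designM1 hit hmea hop hτ.1 hτ.2
  tau_eq τ := by
    rw [bestDesign]
    split_ifs <;> rfl
  size_lt ζ hζ hne := by
    rcases le_or_gt ζ.τ C.tauL with h1 | h1
    · rw [(best_of_le_tauL h1).1] at hne ⊢
      refine size_lt_designN1 hit hmea hop hδ hζ ?_ hne
      have h4 : 0 < 1 - 2 * C.it := by linarith
      rw [tauL, le_div_iff₀ (by positivity)] at h1
      linarith
    rcases le_or_gt ζ.τ C.tauU with h2 | h2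
    · rw [(best_of_mem_Icc hit hmea hop hκ h1.le h2).1] at hne ⊢
      exact size_lt_designNM hit hmea hop hδ hζ hne
    · rw [(best_of_tauU_le hit hmea hop hκ h2.le).1] at hne ⊢
      exact size_lt_designM1 hit hmea hop hδ hζ h2.le hne
  hasDerivAt τ hτ := by
    obtain ⟨hτ0, hτ1⟩ := Icc_subset_Ioo hit hmea hop hδ hτ
    have hlu := tauL_lt_tauU hit hmea hop hκ
    obtain ⟨u1, u2, -⟩ := designNM_tauU hit hmea hop
    obtain ⟨l1, l2, -⟩ := designNM_tauL hit hmea hop hκ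
    have h := hasDerivAt_ite_le (e := C.tauL) (x := τ)
      (hasDerivAt_logSize_designN1 hmea hop (by linarith) hτ0)
      (hasDerivAt_ite_le (e := C.tauU) (x := τ)
        (f₁ := fun t => (C.designNM t).logSize) (f₂ := fun t => (C.designM1 t).logSize)
        (k₁ := fun t => -C.K₃ t) (k₂ := fun t => -C.K₂ t)
        (hasDerivAt_logSize_designNM hit hmea hop hτ0)
        (hasDerivAt_logSize_designM1 hit hmea hop hτ1) (by simp only [u1]) (by simp only [u2]))
      (f₁ := fun t => (C.designN1 t).logSize) (k₁ := fun t => -C.K₁ t)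
      (k₂ := fun t => if t ≤ C.tauU then -C.K₃ t else -C.K₂ t)
      (by simp only [if_pos hlu.le, l1]) (by simp only [if_pos hlu.le, l2])
    refine (h.congr_of_eventuallyEq (Eventually.of_forall fun t => ?_)).congr_deriv ?_
    · simp only [bestDesign]
      split_ifs <;> rfl
    · rw [bestRate]
      split_ifs <;> rfl
  crossesDown := by
    have hlu := tauL_lt_tauU hit hmea hop hκ
    obtain ⟨-, u2, -⟩ := designNM_tauU hit hmea hop
    obtain ⟨-, l2, -⟩ := designNM_tauL hit hmea hop hκ
    have h := (crossesDown_K₁ hmea hop hα hq hφ).ite Set.ordConnected_Ioo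
      ((crossesDown_K₃ hit hmea hop hα hq hφ).ite Set.ordConnected_Ioo
        (crossesDown_K₂ hα hq hφ) u2) (e := C.tauL) (by simp only [if_pos hlu.le, l2])
    exact h.mono (Icc_subset_Ioo hit hmea hop hδ)

lemma designN1_tauMax (hit : C.it < 1) (hop : 0 < C.op) :
    C.designN1 C.tauMax = ⟨1, 1, C.tauMax⟩ := by
  have h : 1 - C.it ≠ 0 := by linarith
  have e : C.mea + C.op * ((1 - C.it - C.mea) / C.op) = 1 - C.it := by field_simp; ring
  simp only [designN1, tauMax, e, div_self h]

lemma designM1_tauMax (hit : 0 < C.it) (hmea : 0 < C.mea) (hop : 0 < C.op) :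
    C.designM1 C.tauMax = ⟨1, 1, C.tauMax⟩ := by
  have h : C.it + C.mea ≠ 0 := by positivity
  have e : 1 - C.op * ((1 - C.it - C.mea) / C.op) = C.it + C.mea := by field_simp; ring
  simp only [designM1, tauMax, e, div_self h]

lemma K₁_tauMax : C.K₁ C.tauMax = C.op / (1 - C.it) := by
  rw [K₁, tauMax, ← add_div, inv_div]
  ring_nf

lemma K₂_tauMax : C.K₂ C.tauMax = C.op / (C.it + C.mea) := by
  rw [K₂, tauMax, ← sub_div, inv_div]
  ring_nf

end Costs

/-! ### Assembly of the theorem -/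

lemma hasLogEfficiency_objective (crit : Criterion) {η p α γ : ℝ} (hα : 0 < α)
    (hh : crit = .V → h₂ η p α γ ≠ 0) :
    HasLogEfficiency (objective η p α γ crit) (logEff η p α γ crit) :=
  ⟨crit.power, crit.power_pos, fun _ hn hm hτ => objective_eq crit hα hh hn hm hτ⟩

/-- If the budget is only just sufficient, there is a single feasible design. -/
lemma isOptimalDesign_of_total_eq_one {C : Costs} {δ : ℝ} (hit : 0 < C.it) (hmea : 0 < C.mea)
    (hop : 0 < C.op) (hδ : 0 < δ) (f : Design → ℝ) (h : C.it + C.mea + C.op * δ = 1) :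
    IsOptimalDesign C δ f ⟨1, 1, δ⟩ := by
  refine ⟨⟨by simp only [Costs.total]; linarith, le_rfl, le_rfl, le_rfl⟩, fun ζ hζ hne => ?_⟩
  obtain ⟨n, m, τ⟩ := ζ
  obtain ⟨ht, hτ, hn, hm⟩ := hζ
  simp only [Costs.total] at ht hτ hn hm
  have h1 : C.mea * (1 * 1) ≤ C.mea * (n * m) := by gcongr
  have h2 : C.op * (1 * δ) ≤ C.op * (m * δ) := by gcongr
  have h3 : C.op * (m * δ) ≤ C.op * (m * τ) := by gcongr
  have h4 : C.it * 1 ≤ C.it * n := by gcongr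
  have e1 : n = 1 := by
    have : C.it * n = C.it * 1 := by linarith
    exact mul_left_cancel₀ hit.ne' this
  have e2 : m = 1 := by
    have : C.op * (m * δ) = C.op * (1 * δ) := by linarith
    exact mul_right_cancel₀ hδ.ne' (mul_left_cancel₀ hop.ne' this)
  have e3 : τ = δ := by
    have : C.op * (m * τ) = C.op * (m * δ) := by linarith
    have := mul_left_cancel₀ hop.ne' this
    rw [e2] at this
    linarith
  exact absurd (by rw [e1, e2, e3]) hne

end GammaDesign

theorem theorem4
    (crit : GammaDesign.Criterion) (C : GammaDesign.Costs) (δ η p α γ : ℝ)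
    (hit : 0 < C.it) (hmea : 0 < C.mea) (hop : 0 < C.op) (hδ : 0 < δ)
    (hη : 0 < η) (hp₀ : 0 < p) (hp₁ : p < 1) (hα : 0 < α)
    (hfeas : C.it + C.mea + C.op * δ ≤ 1) :
    -- sufficient conditions, case by case
    -- case 1
    (∀ τ₁ : ℝ,
      GammaDesign.IsUniqueRootOn (GammaDesign.phi η p α γ crit) C.K₁ (Set.Icc δ C.tauMax) τ₁ →
      ((0 < 1 - 2 * C.it - C.mea ∧ τ₁ < C.tauL ∧ δ < τ₁) ∨
        (1 - 2 * C.it - C.mea ≤ 0 ∧ τ₁ < C.tauMax ∧ δ < τ₁)) →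
      GammaDesign.IsOptimalDesign C δ (GammaDesign.objective η p α γ crit) (C.designN1 τ₁)) ∧
    -- case 2
    (∀ τ₂ : ℝ,
      GammaDesign.IsUniqueRootOn (GammaDesign.phi η p α γ crit) C.K₂ (Set.Icc δ C.tauMax) τ₂ →
      0 < 1 - 2 * C.it - C.mea → τ₂ < C.tauMax → max C.tauU δ < τ₂ →
      GammaDesign.IsOptimalDesign C δ (GammaDesign.objective η p α γ crit) (C.designM1 τ₂)) ∧
    -- case 3
    (∀ τ₃ : ℝ,
      GammaDesign.IsUniqueRootOn (GammaDesign.phi η p α γ crit) C.K₃ (Set.Icc δ C.tauMax) τ₃ →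
      0 < 1 - 2 * C.it - C.mea → τ₃ < C.tauU → max C.tauL δ < τ₃ →
      GammaDesign.IsOptimalDesign C δ (GammaDesign.objective η p α γ crit) (C.designNM τ₃)) ∧
    -- case 4
    (max (C.op / (C.it + C.mea)) (C.op / (1 - C.it)) < GammaDesign.phi η p α γ crit C.tauMax →
      GammaDesign.IsOptimalDesign C δ (GammaDesign.objective η p α γ crit) ⟨1, 1, C.tauMax⟩) ∧
    -- case 5
    (GammaDesign.phi η p α γ crit δ < C.K₁ δ →
      ((0 < 1 - 2 * C.it - C.mea ∧ δ < C.tauL) ∨ 1 - 2 * C.it - C.mea ≤ 0) →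
      GammaDesign.IsOptimalDesign C δ (GammaDesign.objective η p α γ crit) (C.designN1 δ)) ∧
    -- case 6
    (GammaDesign.phi η p α γ crit δ < C.K₂ δ →
      0 < 1 - 2 * C.it - C.mea → C.tauU < δ →
      GammaDesign.IsOptimalDesign C δ (GammaDesign.objective η p α γ crit) (C.designM1 δ)) ∧
    -- case 7
    (GammaDesign.phi η p α γ crit δ < C.K₃ δ →
      0 < 1 - 2 * C.it - C.mea → δ < C.tauU → C.tauL < δ →
      GammaDesign.IsOptimalDesign C δ (GammaDesign.objective η p α γ crit) (C.designNM δ)) ∧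
    -- case 8
    (C.it + C.mea + C.op * δ = 1 →
      GammaDesign.IsOptimalDesign C δ (GammaDesign.objective η p α γ crit) ⟨1, 1, δ⟩) ∧
    -- the optimal design exists and falls into one of the eight cases (boundaries included)
    (∃ ζ : GammaDesign.Design,
      GammaDesign.IsOptimalDesign C δ (GammaDesign.objective η p α γ crit) ζ ∧
      ((ζ = C.designN1 ζ.τ ∧ GammaDesign.phi η p α γ crit ζ.τ = C.K₁ ζ.τ ∧ δ < ζ.τ ∧
          ((0 < 1 - 2 * C.it - C.mea ∧ ζ.τ ≤ C.tauL) ∨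
            (1 - 2 * C.it - C.mea ≤ 0 ∧ ζ.τ < C.tauMax))) ∨
        (ζ = C.designM1 ζ.τ ∧ GammaDesign.phi η p α γ crit ζ.τ = C.K₂ ζ.τ ∧ δ < ζ.τ ∧
          0 < 1 - 2 * C.it - C.mea ∧ C.tauU ≤ ζ.τ ∧ ζ.τ < C.tauMax) ∨
        (ζ = C.designNM ζ.τ ∧ GammaDesign.phi η p α γ crit ζ.τ = C.K₃ ζ.τ ∧ δ < ζ.τ ∧
          0 < 1 - 2 * C.it - C.mea ∧ C.tauL ≤ ζ.τ ∧ ζ.τ ≤ C.tauU) ∨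
        (ζ = ⟨1, 1, C.tauMax⟩ ∧
          max (C.op / (C.it + C.mea)) (C.op / (1 - C.it)) ≤
            GammaDesign.phi η p α γ crit C.tauMax) ∨
        (ζ = C.designN1 δ ∧ GammaDesign.phi η p α γ crit δ ≤ C.K₁ δ ∧
          ((0 < 1 - 2 * C.it - C.mea ∧ δ ≤ C.tauL) ∨ 1 - 2 * C.it - C.mea ≤ 0)) ∨
        (ζ = C.designM1 δ ∧ GammaDesign.phi η p α γ crit δ ≤ C.K₂ δ ∧
          0 < 1 - 2 * C.it - C.mea ∧ C.tauU ≤ δ) ∨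
        (ζ = C.designNM δ ∧ GammaDesign.phi η p α γ crit δ ≤ C.K₃ δ ∧
          0 < 1 - 2 * C.it - C.mea ∧ C.tauL ≤ δ ∧ δ ≤ C.tauU) ∨
        (ζ = ⟨1, 1, δ⟩ ∧ C.it + C.mea + C.op * δ = 1))) := by
  obtain ⟨q, hq, hq'⟩ := GammaDesign.exists_elasticity crit (η := η) (p := p) (γ := γ) hα
    fun _ => GammaDesign.h₂_ne_zero hη hp₀ hp₁ hα
  have hf := GammaDesign.hasLogEfficiency_objective crit (η := η) (p := p) (γ := γ) hα
    fun _ => GammaDesign.h₂_ne_zero hη hp₀ hp₁ hα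
  have hL := fun τ hτ => (hq' τ hτ).1
  have hφ := fun τ hτ => (hq' τ hτ).2
  set φ := GammaDesign.phi η p α γ crit
  set f := GammaDesign.objective η p α γ crit
  have hC := And.intro hit (And.intro hmea hop)
  have hδop : 0 < C.op * δ := mul_pos hop hδ
  have hit₁ : C.it < 1 := by linarith
  have hδτ : δ ≤ C.tauMax := by
    rw [GammaDesign.Costs.tauMax, le_div_iff₀ hop]
    linarith
  have hexp : 1 - 2 * C.it - C.mea ≤ 0 →
      GammaDesign.IsBestResponse C δ φ C.designN1 C.K₁ := fun hκ =>
    GammaDesign.Costs.isBestResponse_designN1 hit hmea hop hδ hκ hit₁ hα hq hφ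
  have hcheap : 0 < 1 - 2 * C.it - C.mea →
      GammaDesign.IsBestResponse C δ φ C.bestDesign C.bestRate := fun hκ =>
    GammaDesign.Costs.isBestResponse_bestDesign hit hmea hop hδ hκ hα hq hφ
  have hL' : ∀ {τ : ℝ}, τ ≤ C.tauL → _ := fun h => GammaDesign.Costs.best_of_le_tauL h
  have hM' := fun hκ τ => @GammaDesign.Costs.best_of_mem_Icc C hit hmea hop hκ τ
  have hU' := fun hκ τ => @GammaDesign.Costs.best_of_tauU_le C hit hmea hop hκ τ
  refine ⟨?_, ?_, ?_, ?_, ?_, ?_, ?_, ?_, ?_⟩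
  · rintro τ ⟨hτ, he, -⟩ (⟨hκ, hl, -⟩ | ⟨hκ, -, -⟩)
    · obtain ⟨e1, e2⟩ := hL' hl.le
      rw [← e1]
      exact (hcheap hκ).isOptimalDesign_of_eq hC hδ hf hL hτ (he.trans e2.symm)
    · exact (hexp hκ).isOptimalDesign_of_eq hC hδ hf hL hτ he
  · rintro τ ⟨hτ, he, -⟩ hκ - hu
    obtain ⟨e1, e2⟩ := hU' hκ τ ((le_max_left _ _).trans hu.le)
    rw [← e1]
    exact (hcheap hκ).isOptimalDesign_of_eq hC hδ hf hL hτ (he.trans e2.symm)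
  · rintro τ ⟨hτ, he, -⟩ hκ hu hl
    obtain ⟨e1, e2⟩ := hM' hκ τ ((le_max_left _ _).trans hl.le) hu.le
    rw [← e1]
    exact (hcheap hκ).isOptimalDesign_of_eq hC hδ hf hL hτ (he.trans e2.symm)
  · intro h
    rcases le_or_gt (1 - 2 * C.it - C.mea) 0 with hκ | hκ
    · rw [← GammaDesign.Costs.designN1_tauMax hit₁ hop]
      refine (hexp hκ).isOptimalDesign_right hC hδ hf hL hδτ ?_
      rw [GammaDesign.Costs.K₁_tauMax]
      exact (le_max_right _ _).trans h.le
    · obtain ⟨e1, e2⟩ := hU' hκ C.tauMax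
        (GammaDesign.Costs.tauU_lt_tauMax hit hmea hop hκ).le
      rw [← GammaDesign.Costs.designM1_tauMax hit hmea hop, ← e1]
      refine (hcheap hκ).isOptimalDesign_right hC hδ hf hL hδτ ?_
      rw [e2, GammaDesign.Costs.K₂_tauMax]
      exact (le_max_left _ _).trans h.le
  · rintro h (⟨hκ, hl⟩ | hκ)
    · obtain ⟨e1, e2⟩ := hL' hl.le
      rw [← e1]
      exact (hcheap hκ).isOptimalDesign_left hC hδ hf hL hδτ (h.le.trans e2.ge)
    · exact (hexp hκ).isOptimalDesign_left hC hδ hf hL hδτ h.le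
  · intro h hκ hu
    obtain ⟨e1, e2⟩ := hU' hκ δ hu.le
    rw [← e1]
    exact (hcheap hκ).isOptimalDesign_left hC hδ hf hL hδτ (h.le.trans e2.ge)
  · intro h hκ hu hl
    obtain ⟨e1, e2⟩ := hM' hκ δ hl.le hu.le
    rw [← e1]
    exact (hcheap hκ).isOptimalDesign_left hC hδ hf hL hδτ (h.le.trans e2.ge)
  · exact GammaDesign.isOptimalDesign_of_total_eq_one hit hmea hop hδ f
  -- The optimum is at `δ`, at `τ_max` or at an interior zero. The degenerate budget `δ = τ_max` is
  -- absorbed by the endpoint alternatives, so the eighth disjunct is never chosen.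
  · rcases le_or_gt (1 - 2 * C.it - C.mea) 0 with hκ | hκ
    · obtain ⟨τ, hτ, hopt, ⟨rfl, h⟩ | ⟨rfl, h⟩ | ⟨h1, h2, h⟩⟩ :=
        (hexp hκ).exists_isOptimalDesign hC hδ hf hL hδτ
      · exact ⟨_, hopt, .inr <| .inr <| .inr <| .inr <| .inl ⟨rfl, h, .inr hκ⟩⟩
      · refine ⟨_, hopt, .inr <| .inr <| .inr <| .inl
          ⟨GammaDesign.Costs.designN1_tauMax hit₁ hop, max_le ?_ ?_⟩⟩
        -- The condition `κ ≤ 0` says `1 - C_it ≤ C_it + C_mea`, so the bound from `K₁` is the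
        -- larger of the two; for `κ > 0` the order is reversed and `K₂` decides.
        · refine le_trans ?_ h
          rw [GammaDesign.Costs.K₁_tauMax]
          exact div_le_div_of_nonneg_left hop.le (by linarith) (by linarith)
        · rwa [GammaDesign.Costs.K₁_tauMax] at h
      · exact ⟨_, hopt, .inl ⟨rfl, h, h1, .inr ⟨hκ, h2⟩⟩⟩
    · have hlu := GammaDesign.Costs.tauL_lt_tauU hit hmea hop hκ
      obtain ⟨τ, hτ, hopt, h⟩ := (hcheap hκ).exists_isOptimalDesign hC hδ hf hL hδτ
      refine ⟨_, hopt, ?_⟩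
      rcases h with ⟨rfl, h⟩ | ⟨rfl, h⟩ | ⟨h1, h2, h⟩
      · rcases le_or_gt τ C.tauL with hl | hl
        · obtain ⟨e1, e2⟩ := hL' hl
          rw [e2] at h
          exact .inr <| .inr <| .inr <| .inr <| .inl ⟨e1, h, .inl ⟨hκ, hl⟩⟩
        rcases le_or_gt τ C.tauU with hu | hu
        · obtain ⟨e1, e2⟩ := hM' hκ τ hl.le hu
          rw [e2] at h
          exact .inr <| .inr <| .inr <| .inr <| .inr <| .inr <| .inl ⟨e1, h, hκ, hl.le, hu⟩
        · obtain ⟨e1, e2⟩ := hU' hκ τ hu.le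
          rw [e2] at h
          exact .inr <| .inr <| .inr <| .inr <| .inr <| .inl ⟨e1, h, hκ, hu.le⟩
      · obtain ⟨e1, e2⟩ := hU' hκ C.tauMax
          (GammaDesign.Costs.tauU_lt_tauMax hit hmea hop hκ).le
        rw [e2, GammaDesign.Costs.K₂_tauMax] at h
        refine .inr <| .inr <| .inr <| .inl
          ⟨e1.trans (GammaDesign.Costs.designM1_tauMax hit hmea hop), max_le h (le_trans ?_ h)⟩
        exact div_le_div_of_nonneg_left hop.le (by linarith) (by linarith)
      · rcases le_or_gt τ C.tauL with hl | hl
        · obtain ⟨e1, e2⟩ := hL' hl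
          rw [e2] at h
          rw [e1]
          exact .inl ⟨rfl, h, h1, .inl ⟨hκ, hl⟩⟩
        rcases le_or_gt τ C.tauU with hu | hu
        · obtain ⟨e1, e2⟩ := hM' hκ τ hl.le hu
          rw [e2] at h
          rw [e1]
          exact .inr <| .inr <| .inl ⟨rfl, h, h1, hκ, hl.le, hu⟩
        · obtain ⟨e1, e2⟩ := hU' hκ τ hu.le
          rw [e2] at h
          rw [e1]
          exact .inr <| .inl ⟨rfl, h, h1, hκ, hu.le, h2⟩
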